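/- **Setting.** Let $(\Psi,\Phi)\in\mathbb R^m\times\mathbb R^d$ be random with $\mathbb E\|\Psi\|^2,\ \mathbb E\|\Phi\|^2<\infty$, let $S\subseteq\mathbb R^d$ be measurable, and let $\lambda\in(0,1)$ (temperature). For a strictly convex, twice Fréchet differentiable $\rho$ on a Euclidean space let $d_\rho(x,\mu)=\rho(x)-\rho(\mu)-D\rho(\mu)(x-\mu)$; fix such divergences $d$ on $\mathbb R^d$ and on $\mathbb R^{m+d}$. The slow variable is $\xi=(\rho_i,\sigma_i)_{i=1}^K$ with $\rho_i\in\mathbb R$, $\sigma_i\in\mathbb R^d$; its codevectors are $\hat\phi_i=\sigma_i/\rho_i$, its Voronoi cells are $\Sigma_i(\xi)=\{\phi\in S: i=\arg\min_j d(\phi,\hat\phi_j)\}$ (smallest index in case of ties). The fast variable is $\bar\theta=(\bar\theta_1,\dots,\bar\theta_s)$, $\bar\theta_i\in\mathbb R^{md}$. A fixed map $c:\{1,\dots,K\}\to\{1,\dots,s\}$ assigns cells to modes, and $S_i(\xi)=\bigcup_{c(j)=i}\Sigma_j(\xi)$. Put $$\epsilon(\xi,\bar\theta;\psi,\phi)=\sum_i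 \mathbf 1_{[\phi\in S_i(\xi)]}[\phi^{T}\otimes I_m]\bar\theta_i-\psi,\qquad h_\theta(\xi,\bar\theta)=-\nabla_{\bar\theta}\tfrac12\mathbb E\|\epsilon(\xi,\bar\theta;\Psi,\Phi)\|^2,$$ $$\hat p_i=\frac{\rho_i e^{-\frac{1-\lambda}{\lambda}d(x,\mu_i)}}{\sum_j\rho_j e^{-\frac{1-\lambda}{\lambda}d(x,\mu_j)}},\quad x=(\psi,\phi),\quad \mu_i=([\phi^T\otimes I_m]\bar\theta_{c(i)},\hat\phi_i),\qquad h_\phi(\xi,\bar\theta)=\big(\mathbb E[\hat p_i]-\rho_i,\ \mathbb E[\Phi\hat p_i]-\sigma_i\big)_{i}.$$ **Assumptions.** $D$ is an open set of states $\xi$ with all $\rho_i>0$ such that (a) (persistence of excitation) $\mathbb E[\mathbf 1_{[\Phi\in S_i(\xi)]}\Phi\Phi^T]$ is positive definite for every $\xi\in D$ and every $i$; (b) $h_\theta$ and $h_\phi$ are locally Lipschitz on $D\times\mathbb R^{smd}$. **Claim 1.** There is a locally Lipschitz map $\xi\mapsto\Lambda(\xi)$ on $D$ such that, for every fixed $\xi\in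 D$, $\Lambda(\xi)$ is a globally asymptotically stable equilibrium of the fast ODE $\dot{\bar\theta}=h_\theta(\xi,\bar\theta)$. **Claim 2.** Suppose that the slow ODE $\dot\xi=h_\phi(\xi,\Lambda(\xi))$ on $D$ has an asymptotically stable equilibrium $\xi^*\in D$, with domain of attraction $B\subseteq D$. Let $\alpha(t),\beta(t)>0$ with $\sum\alpha=\sum\beta=\infty$, $\sum(\alpha^2+\beta^2)<\infty$, $\beta/\alpha\to0$, and let $(\xi(t),\bar\theta(t))$ be generated from observations $x_t=(\psi_t,\phi_t)$ by $$\rho_i(t+1)=\rho_i(t)+\beta(t)[\hat p_i(t)-\rho_i(t)],\quad \sigma_i(t+1)=\sigma_i(t)+\beta(t)[\phi_t\hat p_i(t)-\sigma_i(t)],$$ $$\bar\theta_i(t+1)=\bar\theta_i(t)-\alpha(t)\mathbf 1_{[\phi_t\in S_i(\xi(t))]}[\phi_t^T\otimes I_m]^T\epsilon(\xi(t),\bar\theta(t);x_t).$$ Suppose that, for some filtration to which the iterates are adapted, the deviations of the two update directions from $h_\phi$ and $h_\theta$ are square-integrable martingale difference sequences whose conditional second moments are at most $C(1+\|\xi(t)\|^2+\|\bar\theta(t)\|^2)$.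 Then almost surely, if $\xi(t)$ eventually stays in some compact subset of $B$ (which may depend on the realization), we have $(\xi(t),\bar\theta(t))\to(\xi^*,\Lambda(\xi^*))$. Consequently the codevectors converge, $\hat\phi_i(t)\to\hat\phi_i^*$, and so does the Voronoi partition: every $\phi\in S$ with a unique nearest limit codevector satisfies, for all $i$ and all large $t$, $\phi\in\Sigma_i(\xi(t))\iff\phi\in\Sigma_i(\xi^*)$; if the $\hat\phi_i^*$ are distinct, the same equivalence holds for every $i$, Lebesgue-almost every $\phi$ and all large $t$. -/

import Mathlib

open Set Filter Topology MeasureTheory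

noncomputable section

/-! ### Bregman divergences -/

/-- Generators of Bregman divergences: strictly convex, twice Fréchet differentiable functions on
a vector space. -/
structure IsBregmanGenerator {V : Type*} [NormedAddCommGroup V] [NormedSpace ℝ V]
    (ρ : V → ℝ) : Prop where
  strictConvex : StrictConvexOn ℝ univ ρ
  differentiable : Differentiable ℝ ρ
  differentiable_fderiv : Differentiable ℝ (fderiv ℝ ρ)

/-- `d_ρ(x, μ) = ρ(x) - ρ(μ) - Dρ(μ)(x - μ)`. -/
def bregmanDiv {V : Type*} [NormedAddCommGroup V] [NormedSpace ℝ V]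
    (ρ : V → ℝ) (x μ : V) : ℝ :=
  ρ x - ρ μ - fderiv ℝ ρ μ (x - μ)

/-! ### Asymptotic stability of autonomous differential equations on a set `U` -/

section Stability

variable {V : Type*} [NormedAddCommGroup V] [NormedSpace ℝ V]

/-- `γ` solves `γ' = f(γ)` on `[0, ∞)` and stays in `U`. -/
def IsForwardSolution (f : V → V) (U : Set V) (γ : ℝ → V) : Prop :=
  IsIntegralCurveOn γ (fun _ => f) (Ici 0) ∧ ∀ t, 0 ≤ t → γ t ∈ U

/-- The domain of attraction of `x` for `γ' = f(γ)` in `U`: the initial points from which a solution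
exists for all `t ≥ 0` in `U`, and all such solutions converge to `x`. -/
def basinOfAttraction (f : V → V) (U : Set V) (x : V) : Set V :=
  {x₀ | (∃ γ, IsForwardSolution f U γ ∧ γ 0 = x₀) ∧
    ∀ γ, IsForwardSolution f U γ → γ 0 = x₀ → Tendsto γ atTop (𝓝 x)}

/-- `x ∈ U` is an asymptotically stable equilibrium of `γ' = f(γ)` in `U`: an equilibrium that is
Lyapunov stable and attracts a neighbourhood. -/
structure IsAsymptoticallyStable (f : V → V) (U : Set V) (x : V) : Prop where
  mem : x ∈ U
  equilibrium : f x = 0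
  stable : ∀ ε > 0, ∃ δ > 0, ∀ γ, IsForwardSolution f U γ → dist (γ 0) x < δ →
    ∀ t, 0 ≤ t → dist (γ t) x < ε
  attractive : basinOfAttraction f U x ∈ 𝓝 x

/-- Global asymptotic stability on the whole space. -/
def IsGloballyAsymptoticallyStable (f : V → V) (x : V) : Prop :=
  IsAsymptoticallyStable f univ x ∧ basinOfAttraction f univ x = univ

end Stability

/-! ### The identification model -/

/-- The slow variable `ξ = (ξ_i)_i`, with `ξ_i = (ρ_i, σ_i)`. -/
abbrev CodeState (K d : ℕ) : Type := Fin K → ℝ × EuclideanSpace ℝ (Fin d)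

/-- The fast variable `θ = (θ_i)_i`, with `θ_i = vec(Θ_i) ∈ ℝ^{md}`; the coordinate `(a, k)` of
`θ_i` is the entry of the `m × d` matrix `Θ_i` in row `k` and column `a`. -/
abbrev ParamState (s d m : ℕ) : Type :=
  PiLp 2 (fun _ : Fin s => EuclideanSpace ℝ (Fin d × Fin m))

/-- One observation `x = (ψ, φ)`. -/
abbrev Observation (m d : ℕ) : Type :=
  EuclideanSpace ℝ (Fin m) × EuclideanSpace ℝ (Fin d)

/-- The local model `z(φ, θ_i) = [φᵀ ⊗ I_m] θ_i = Θ_i φ`. -/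
def localModel {d m : ℕ} (φ : EuclideanSpace ℝ (Fin d))
    (ϑ : EuclideanSpace ℝ (Fin d × Fin m)) : EuclideanSpace ℝ (Fin m) :=
  WithLp.toLp 2 fun k => ∑ a, φ a * ϑ (a, k)

/-- `[φᵀ ⊗ I_m]ᵀ e`. -/
def localModelTranspose {d m : ℕ} (φ : EuclideanSpace ℝ (Fin d))
    (e : EuclideanSpace ℝ (Fin m)) : EuclideanSpace ℝ (Fin d × Fin m) :=
  WithLp.toLp 2 fun p => φ p.1 * e p.2

/-- The codevector `σ_i / ρ_i`. -/
def codevector {K d : ℕ} (ξ : CodeState K d) (i : Fin K) : EuclideanSpace ℝ (Fin d) :=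
  (ξ i).1⁻¹ • (ξ i).2

/-- The data of the problem at a fixed temperature: `K` codevectors, `s` local models. -/
structure IdentModel (m d K s : ℕ) where
  /-- the domain of the regressors -/
  S : Set (EuclideanSpace ℝ (Fin d))
  measurableSet_S : MeasurableSet S
  /-- generator of the divergence between regressors, which defines the Voronoi cells -/
  genS : EuclideanSpace ℝ (Fin d) → ℝ
  genS_bregman : IsBregmanGenerator genS
  /-- generator of the divergence between observations and augmented codevectors -/
  genX : Observation m d → ℝ
  genX_bregman : IsBregmanGenerator genX
  /-- cell `j` belongs to the region of mode `assign j` -/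
  assign : Fin K → Fin s
  /-- the temperature -/
  temp : ℝ
  temp_pos : 0 < temp
  temp_lt_one : temp < 1
  /-- the joint law of `(Ψ, Φ)` -/
  law : Measure (Observation m d)
  isProbabilityMeasure_law : IsProbabilityMeasure law
  /-- the mean squared error is finite -/
  integrable_sq_output : Integrable (fun x => ‖x.1‖ ^ 2) law
  integrable_sq_regressor : Integrable (fun x => ‖x.2‖ ^ 2) law

namespace IdentModel

variable {m d K s : ℕ} (A : IdentModel m d K s)

/-- The Voronoi cell `{φ ∈ S : i = argmin_j d(φ, φ̂_j)}`; ties go to the smallest index, so that the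
cells form a partition of `S`. -/
def cell (ξ : CodeState K d) (i : Fin K) : Set (EuclideanSpace ℝ (Fin d)) :=
  {φ | φ ∈ A.S ∧
    (∀ j, bregmanDiv A.genS φ (codevector ξ i) ≤ bregmanDiv A.genS φ (codevector ξ j)) ∧
    ∀ j < i, bregmanDiv A.genS φ (codevector ξ i) < bregmanDiv A.genS φ (codevector ξ j)}

/-- The region of mode `i`: the union of the cells assigned to it. -/
def region (ξ : CodeState K d) (i : Fin s) : Set (EuclideanSpace ℝ (Fin d)) :=
  ⋃ j, ⋃ (_ : A.assign j = i), A.cell ξ j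

/-! #### Fast iteration: recursive least squares -/

/-- The error `∑_i 1[φ ∈ S_i] [φᵀ ⊗ I_m] θ_i - ψ`. -/
def error (ξ : CodeState K d) (θ : ParamState s d m) (x : Observation m d) :
    EuclideanSpace ℝ (Fin m) :=
  (∑ i, (A.region ξ i).indicator (fun φ => localModel φ (θ i)) x.2) - x.1

/-- The identification objective `½ E‖ε‖²`. -/
def loss (ξ : CodeState K d) (θ : ParamState s d m) : ℝ :=
  2⁻¹ * ∫ x, ‖A.error ξ θ x‖ ^ 2 ∂A.law

/-- `h_θ(ξ, θ) = -∇_θ ½ E‖ε‖²`. -/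
def hFast (ξ : CodeState K d) (θ : ParamState s d m) : ParamState s d m :=
  -gradient (A.loss ξ) θ

/-- The stochastic gradient direction, whose `i`-th block is `-1[φ ∈ S_i] [φᵀ ⊗ I_m]ᵀ ε`. -/
def fastUpdate (ξ : CodeState K d) (θ : ParamState s d m) (x : Observation m d) :
    ParamState s d m :=
  WithLp.toLp 2 fun i =>
    -(A.region ξ i).indicator (fun φ => localModelTranspose φ (A.error ξ θ x)) x.2

/-- Persistence of excitation of mode `i`: `E[1[Φ ∈ S_i] Φ Φᵀ]` is positive definite. -/
def PersistentlyExciting (ξ : CodeState K d) (i : Fin s) : Prop :=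
  (Matrix.of fun a b : Fin d =>
    ∫ x, (A.region ξ i).indicator (fun φ => φ a * φ b) x.2 ∂A.law).PosDef

/-! #### Slow iteration: online deterministic annealing -/

/-- The augmented codevector `μ_i = (z(φ, θ̂_i), φ̂_i)`, where `θ̂_i` is the parameter of the mode to
which cell `i` is assigned. -/
def augmentedCodevector (ξ : CodeState K d) (θ : ParamState s d m)
    (φ : EuclideanSpace ℝ (Fin d)) (i : Fin K) : Observation m d :=
  (localModel φ (θ (A.assign i)), codevector ξ i)

/-- `ρ_i exp(-((1-λ)/λ) d(x, μ_i))`. -/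
def gibbsWeight (ξ : CodeState K d) (θ : ParamState s d m) (x : Observation m d)
    (i : Fin K) : ℝ :=
  (ξ i).1 * Real.exp (-((1 - A.temp) / A.temp) *
    bregmanDiv A.genX x (A.augmentedCodevector ξ θ x.2 i))

/-- The estimated association probability `p̂_i`. -/
def assocProb (ξ : CodeState K d) (θ : ParamState s d m) (x : Observation m d)
    (i : Fin K) : ℝ :=
  A.gibbsWeight ξ θ x i / ∑ j, A.gibbsWeight ξ θ x j

/-- The update direction `(p̂_i - ρ_i, φ p̂_i - σ_i)_i`. -/
def slowUpdate (ξ : CodeState K d) (θ : ParamState s d m) (x : Observation m d) :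
    CodeState K d :=
  fun i => (A.assocProb ξ θ x i - (ξ i).1, A.assocProb ξ θ x i • x.2 - (ξ i).2)

/-- The mean field `h_φ(ξ, θ) = (E[p̂_i] - ρ_i, E[Φ p̂_i] - σ_i)_i`. -/
def hSlow (ξ : CodeState K d) (θ : ParamState s d m) : CodeState K d :=
  fun i => (∫ x, A.assocProb ξ θ x i ∂A.law - (ξ i).1,
    ∫ x, A.assocProb ξ θ x i • x.2 ∂A.law - (ξ i).2)

end IdentModel

/-! ### The coupled stochastic recursion -/

/-- Two-timescale step sizes. -/
structure IsTwoTimescaleSteps (α β : ℕ → ℝ) : Prop where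
  pos_fast : ∀ t, 0 < α t
  pos_slow : ∀ t, 0 < β t
  sum_fast : ¬ Summable α
  sum_slow : ¬ Summable β
  sum_sq : Summable fun t => α t ^ 2 + β t ^ 2
  ratio : Tendsto (fun t => β t / α t) atTop (𝓝 0)

/-- `M 0, M 1, …` (where `M t` is the noise of the step from `t` to `t + 1`) is a square-integrable
martingale difference sequence with conditional second moments at most `C (1 + R t)`. -/
structure IsMartingaleDifferenceNoise {Ω V : Type*} [MeasurableSpace Ω]
    [NormedAddCommGroup V] [NormedSpace ℝ V] [CompleteSpace V]
    (μ : Measure Ω) (ℱ : Filtration ℕ ‹MeasurableSpace Ω›) (M : ℕ → Ω → V) (R : ℕ → Ω → ℝ) :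
    Prop where
  adapted : ∀ t, StronglyMeasurable[ℱ (t + 1)] (M t)
  integrable : ∀ t, Integrable (M t) μ
  integrable_sq : ∀ t, Integrable (fun ω => ‖M t ω‖ ^ 2) μ
  condExp_eq_zero : ∀ t, μ[M t|ℱ t] =ᵐ[μ] 0
  condExp_sq_le : ∃ C : ℝ, ∀ t, ∀ᵐ ω ∂μ, (μ[fun ω => ‖M t ω‖ ^ 2|ℱ t]) ω ≤ C * (1 + R t ω)

/-- `(ξ, θ)` is the run of the two coupled recursions driven by the observations
`X t = (ψ_t, φ_t)`; with respect to the filtration `ℱ`, the deviations of the update directions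
from the mean fields are martingale difference sequences. -/
structure IsIdentRun {m d K s : ℕ} (A : IdentModel m d K s) {Ω : Type*} [MeasurableSpace Ω]
    (μ : Measure Ω) (ℱ : Filtration ℕ ‹MeasurableSpace Ω›) (α β : ℕ → ℝ)
    (X : ℕ → Ω → Observation m d) (ξ : ℕ → Ω → CodeState K d) (θ : ℕ → Ω → ParamState s d m) :
    Prop where
  adapted_slow : StronglyAdapted ℱ ξ
  adapted_fast : StronglyAdapted ℱ θ
  slow_step : ∀ t ω, ξ (t + 1) ω = ξ t ω + β t • A.slowUpdate (ξ t ω) (θ t ω) (X t ω)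
  fast_step : ∀ t ω, θ (t + 1) ω = θ t ω + α t • A.fastUpdate (ξ t ω) (θ t ω) (X t ω)
  slow_noise : IsMartingaleDifferenceNoise μ ℱ
    (fun t ω => A.slowUpdate (ξ t ω) (θ t ω) (X t ω) - A.hSlow (ξ t ω) (θ t ω))
    (fun t ω => ‖ξ t ω‖ ^ 2 + ‖θ t ω‖ ^ 2)
  fast_noise : IsMartingaleDifferenceNoise μ ℱ
    (fun t ω => A.fastUpdate (ξ t ω) (θ t ω) (X t ω) - A.hFast (ξ t ω) (θ t ω))
    (fun t ω => ‖ξ t ω‖ ^ 2 + ‖θ t ω‖ ^ 2)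

/-- Convergence of the Voronoi partitions of `ξ t` to that of `ξ'`: every regressor with a unique
nearest limit codevector is eventually in the same cell as in the limit partition; and if the limit
codevectors are distinct, this holds for Lebesgue-almost every regressor. -/
def PartitionTendsto {m d K s : ℕ} (A : IdentModel m d K s) (ξ : ℕ → CodeState K d)
    (ξ' : CodeState K d) : Prop :=
  (∀ φ ∈ A.S, (∃ i, ∀ j, j ≠ i →
      bregmanDiv A.genS φ (codevector ξ' i) < bregmanDiv A.genS φ (codevector ξ' j)) →
    ∀ i, ∀ᶠ t in atTop, (φ ∈ A.cell (ξ t) i ↔ φ ∈ A.cell ξ' i)) ∧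
  (Function.Injective (codevector ξ') →
    ∀ i, ∀ᵐ φ, ∀ᶠ t in atTop, (φ ∈ A.cell (ξ t) i ↔ φ ∈ A.cell ξ' i))

end

/-! For fixed ξ the predictor is linear in θ, so the loss is quadratic and its negative gradient is
affine: h_θ(ξ, θ) = h_θ(ξ, 0) - G(ξ)θ. The form ⟪u, G(ξ)u⟫ is the second moment of the predictor of
u, and persistence of excitation makes it positive definite (`inner_infoOperator_pos`). Hence there
is a unique zero Λ(ξ), all solutions approach it exponentially fast, and the coercivity estimate
`norm_equilibrium_sub_le` hands the local Lipschitz property of h_θ down to Λ.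

Claim 2 is the ODE method on two time scales. The fast iterates are not assumed bounded, although
the noise variance may grow with them. `ae_exists_tendsto_noise` therefore localizes: on the event
that ξ has stayed in a fixed compact set since step n₀, with θ bounded at step n₀, the contraction
of the fast drift dominates the noise, second moments of θ stay bounded, and the weighted noise
series converge as L²-bounded martingales. Countably many such events cover all realizations of
interest.

The rest is deterministic. Adding the tails of the noise series to the iterates gives noise-free
recursions that differ from the iterates by o(1). The fast one contracts towards Λ(ξ), which moves
only by O(β) = o(α) per step, so θ - Λ(ξ) → 0 (`tendsto_sub_equilibrium`). The slow one is then a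
perturbed Euler scheme for the slow ODE; its limit set is compact, lies in the domain of attraction
and is invariant forwards and backwards, and stability reduces such a set to the equilibrium
(`tendsto_of_perturbed_of_basin`).

Codevectors are continuous in ξ, and a strict minimum among finitely many divergences survives small
perturbations. Ties between distinct codevectors lie on hyperplanes, because a difference of Bregman
divergences with the same first argument is affine in that argument. -/

/-! ### The clock of a step-size sequence -/

/-- The time elapsed after `n` steps of sizes `β 0, β 1, …`. -/
noncomputable def stepTime (β : ℕ → ℝ) (n : ℕ) : ℝ := ∑ i ∈ Finset.range n, β i

lemma stepTime_succ (β : ℕ → ℝ) (n : ℕ) : stepTime β (n + 1) = stepTime β n + β n :=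
  Finset.sum_range_succ _ _

lemma stepTime_mono {β : ℕ → ℝ} (hβ : ∀ n, 0 < β n) : Monotone (stepTime β) :=
  monotone_nat_of_le_succ fun n => by rw [stepTime_succ]; linarith [hβ n]

lemma tendsto_stepTime {β : ℕ → ℝ} (hβ : ∀ n, 0 < β n) (hsum : ¬ Summable β) :
    Tendsto (stepTime β) atTop atTop :=
  (not_summable_iff_tendsto_nat_atTop_of_nonneg fun n => (hβ n).le).1 hsum

/-- The first step that is at least the time `T` after step `n`. -/
lemma exists_stepTime_after {β : ℕ → ℝ} (hβ : ∀ n, 0 < β n) (hsum : ¬ Summable β) (n : ℕ) {T : ℝ}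
    (hT : 0 ≤ T) :
    ∃ m, n ≤ m ∧ T ≤ stepTime β m - stepTime β n ∧
      ∀ b, (∀ j, n ≤ j → β j ≤ b) → stepTime β m - stepTime β n ≤ T + b := by
  have hex : ∃ m, n ≤ m ∧ T ≤ stepTime β m - stepTime β n := by
    obtain ⟨m, hm, hm'⟩ := (((tendsto_stepTime hβ hsum).eventually_ge_atTop
      (T + stepTime β n)).and (eventually_ge_atTop n)).exists
    exact ⟨m, hm', by linarith⟩
  classical
  refine ⟨Nat.find hex, (Nat.find_spec hex).1, (Nat.find_spec hex).2, fun b hb => ?_⟩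
  have hb0 : 0 ≤ b := (hβ n).le.trans (hb n le_rfl)
  rcases (Nat.find_spec hex).1.eq_or_lt with h | h
  · rw [← h]; linarith
  · obtain ⟨k, hk⟩ : ∃ k, Nat.find hex = k + 1 := ⟨Nat.find hex - 1, by omega⟩
    have hnk : n ≤ k := by omega
    have := Nat.find_min hex (m := k) (by omega)
    push Not at this
    have := this hnk
    rw [hk, stepTime_succ]
    linarith [hb k hnk]

/-- The last step that is at least the time `T` before step `m`. -/
lemma exists_stepTime_before {β : ℕ → ℝ} {T : ℝ} {m : ℕ} (hm : T ≤ stepTime β m) :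
    ∃ n, n ≤ m ∧ T ≤ stepTime β m - stepTime β n ∧
      (n = m ∨ stepTime β m - stepTime β n ≤ T + β n) := by
  classical
  let P : ℕ → Prop := fun n => T ≤ stepTime β m - stepTime β n
  have h0 : P 0 := by simpa [P, stepTime] using hm
  refine ⟨Nat.findGreatest P m, Nat.findGreatest_le m,
    Nat.findGreatest_spec (P := P) (Nat.zero_le m) h0, ?_⟩
  -- Below m, the next index is already less than T before m, so the overshoot is at most the single
  -- step β n.
  rcases (Nat.findGreatest_le (P := P) m).eq_or_lt with h | h
  · exact Or.inl h
  · right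
    have := Nat.findGreatest_is_greatest (P := P) (Nat.lt_succ_self _) h
    simp only [P, Nat.succ_eq_add_one, stepTime_succ] at this ⊢
    linarith

/-! ### Solutions of differential equations -/

section Tracking

variable {V : Type*} [NormedAddCommGroup V] [NormedSpace ℝ V]

lemma IsForwardSolution.continuousOn {f : V → V} {U : Set V} {γ : ℝ → V}
    (h : IsForwardSolution f U γ) : ContinuousOn γ (Ici 0) :=
  fun t ht => (h.1 t ht).continuousWithinAt

lemma IsForwardSolution.hasDerivWithinAt_Ici {f : V → V} {U : Set V} {γ : ℝ → V}
    (h : IsForwardSolution f U γ) {t : ℝ} (ht : 0 ≤ t) :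
    HasDerivWithinAt γ (f (γ t)) (Ici t) t :=
  (h.1 t ht).mono (Ici_subset_Ici.2 ht)

open scoped Pointwise in
lemma IsForwardSolution.shift {f : V → V} {U : Set V} {γ : ℝ → V}
    (h : IsForwardSolution f U γ) {T : ℝ} (hT : 0 ≤ T) :
    IsForwardSolution f U (fun t => γ (t + T)) := by
  have hmem : Ici (0 : ℝ) ⊆ -T +ᵥ (Ici 0 : Set ℝ) := fun t ht => by
    rw [mem_vadd_set_iff_neg_vadd_mem]
    simpa [add_comm] using add_nonneg (mem_Ici.1 ht) hT
  refine ⟨fun t ht => ?_, fun t ht => h.2 _ (add_nonneg ht hT)⟩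
  exact (h.1.comp_add T t (hmem ht)).mono hmem

/-- The error of one Euler step. -/
lemma norm_sub_euler_le {f : V → V} {U E : Set V} {γ : ℝ → V} (hγ : IsForwardSolution f U γ)
    {L : NNReal} (hL : LipschitzOnWith L f E) {M : ℝ} (hM : ∀ x ∈ E, ‖f x‖ ≤ M) {a b : ℝ}
    (ha : 0 ≤ a) (hab : a ≤ b) (hE : ∀ t ∈ Icc a b, γ t ∈ E) :
    ‖γ b - γ a - (b - a) • f (γ a)‖ ≤ (b - a) * (L * M * (b - a)) := by
  have hM0 : 0 ≤ M := (norm_nonneg _).trans (hM _ (hE a ⟨le_rfl, hab⟩))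
  have hc : ContinuousOn γ (Icc a b) := hγ.continuousOn.mono fun t ht => ha.trans ht.1
  have h1 : ∀ t ∈ Icc a b, ‖γ t - γ a‖ ≤ M * (t - a) := fun t ht =>
    norm_image_sub_le_of_norm_deriv_right_le_segment (f' := fun t => f (γ t))
      hc (fun t ht => hγ.hasDerivWithinAt_Ici (ha.trans ht.1))
      (fun t ht => hM _ (hE t ⟨ht.1, ht.2.le⟩)) t ht
  -- Mean value inequality for γ minus its tangent line at a. The derivative is f(γ t) - f(γ a),
  -- small by the Lipschitz bound because γ has speed at most M.
  have h2 := norm_image_sub_le_of_norm_deriv_right_le_segment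
    (f := fun t => γ t - (t - a) • f (γ a)) (f' := fun t => f (γ t) - f (γ a))
    (C := L * M * (b - a)) (a := a) (b := b) (by fun_prop)
    (fun t ht => by
      have := ((hasDerivAt_id t).sub_const a).smul_const (f (γ a))
      rw [one_smul] at this
      exact (hγ.hasDerivWithinAt_Ici (ha.trans ht.1)).sub this.hasDerivWithinAt)
    (fun t ht => by
      have h3 := hL.dist_le_mul _ (hE t ⟨ht.1, ht.2.le⟩) _ (hE a ⟨le_rfl, hab⟩)
      rw [dist_eq_norm, dist_eq_norm] at h3
      have h4 := h1 t ⟨ht.1, ht.2.le⟩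
      calc _ ≤ L * ‖γ t - γ a‖ := h3
        _ ≤ L * (M * (b - a)) := by
          gcongr
          exact h4.trans (by gcongr; exact ht.2.le)
        _ = _ := by ring) b ⟨hab, le_rfl⟩
  calc _ = ‖γ b - (b - a) • f (γ a) - (γ a - (a - a) • f (γ a))‖ := by
        congr 1; simp; abel
    _ ≤ _ := h2
    _ = _ := by ring

/-- Discrete Grönwall inequality for a perturbed Euler scheme. -/
lemma norm_sub_solution_le {f : V → V} {U E : Set V} {γ : ℝ → V} (hγ : IsForwardSolution f U γ)
    {L : NNReal} (hL : LipschitzOnWith L f E) {M : ℝ} (hM : ∀ x ∈ E, ‖f x‖ ≤ M)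
    {β : ℕ → ℝ} (hβ : ∀ n, 0 < β n) {x y w : ℕ → V}
    (hy : ∀ n, y (n + 1) = y n + β n • w n) {η T : ℝ} {n : ℕ} (hγE : ∀ t ∈ Icc 0 T, γ t ∈ E)
    (hx : ∀ j, n ≤ j → x j ∈ E)
    (hη : ∀ j, n ≤ j → ‖w j - f (x j)‖ + L * ‖x j - y j‖ + L * M * β j ≤ η)
    {m : ℕ} (hnm : n ≤ m) (hT : stepTime β m - stepTime β n ≤ T) :
    ‖y m - γ (stepTime β m - stepTime β n)‖ ≤
      (‖y n - γ 0‖ + η * (stepTime β m - stepTime β n)) *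
        Real.exp (L * (stepTime β m - stepTime β n)) := by
  have hmono := stepTime_mono hβ
  induction m, hnm using Nat.le_induction with
  | base => simp
  | succ m hnm ih =>
    have hs0 : 0 ≤ stepTime β m - stepTime β n := sub_nonneg.2 (hmono hnm)
    rw [stepTime_succ] at hT ⊢
    have hb := hβ m
    specialize ih (by linarith)
    set s := stepTime β m - stepTime β n with hs
    have hs' : stepTime β m + β m - stepTime β n = s + β m := by rw [hs]; ring
    rw [hs'] at hT ⊢
    have hM0 : 0 ≤ M := (norm_nonneg _).trans (hM _ (hx n le_rfl))
    have hη0 : 0 ≤ η := le_trans (by have := hβ n; positivity) (hη n le_rfl)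
    have he := norm_sub_euler_le hγ hL hM hs0 (le_add_of_nonneg_right hb.le) (fun t ht =>
      hγE t ⟨hs0.trans ht.1, ht.2.trans hT⟩)
    rw [add_sub_cancel_left] at he
    have hl := hL.dist_le_mul _ (hx m hnm) _ (hγE s ⟨hs0, by linarith⟩)
    rw [dist_eq_norm, dist_eq_norm] at hl
    have hl2 : ‖x m - γ s‖ ≤ ‖x m - y m‖ + ‖y m - γ s‖ := norm_sub_le_norm_sub_add_norm_sub _ _ _
    -- The new error consists of the old one, the perturbation of the direction, the effect of
    -- evaluating f at x m instead of γ s, and the local Euler error. All but the part proportional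
    -- to the old error is covered by β η.
    have hdec : y (m + 1) - γ (s + β m) = (y m - γ s) + β m • (w m - f (x m))
        + β m • (f (x m) - f (γ s)) - (γ (s + β m) - γ s - β m • f (γ s)) := by
      rw [hy]; simp only [smul_sub]; abel
    have hmain : ‖y (m + 1) - γ (s + β m)‖ ≤ (1 + L * β m) * ‖y m - γ s‖ + β m * η := by
      have t1 : ‖y (m + 1) - γ (s + β m)‖ ≤ ‖y m - γ s‖ + β m * ‖w m - f (x m)‖
          + β m * ‖f (x m) - f (γ s)‖ + β m * (L * M * β m) := by
        rw [hdec]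
        refine (norm_sub_le _ _).trans (add_le_add ((norm_add₃_le).trans ?_) he)
        rw [norm_smul, norm_smul, Real.norm_of_nonneg hb.le]
      have t2 : ‖f (x m) - f (γ s)‖ ≤ L * (‖x m - y m‖ + ‖y m - γ s‖) :=
        hl.trans (by gcongr)
      have t3 := mul_le_mul_of_nonneg_left (hη m hnm) hb.le
      have t4 := mul_le_mul_of_nonneg_left t2 hb.le
      nlinarith
    -- The growth factor of one step is absorbed into the exponential; since the exponential is at
    -- least 1, the newly added error can be put under it as well.
    have hexp : 1 + L * β m ≤ Real.exp (L * β m) := by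
      linarith [Real.add_one_le_exp (L * β m)]
    have hexp1 : 1 ≤ Real.exp (L * (s + β m)) :=
      Real.one_le_exp (by positivity)
    have heq : Real.exp (L * (s + β m)) = Real.exp (L * β m) * Real.exp (L * s) := by
      rw [← Real.exp_add]; ring_nf
    calc _ ≤ (1 + L * β m) * ‖y m - γ s‖ + β m * η := hmain
      _ ≤ Real.exp (L * β m) * ((‖y n - γ 0‖ + η * s) * Real.exp (L * s)) + β m * η * 1 := by
        rw [mul_one]; gcongr
      _ ≤ (‖y n - γ 0‖ + η * s) * Real.exp (L * (s + β m))
          + β m * η * Real.exp (L * (s + β m)) := by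
        rw [heq]
        refine add_le_add (le_of_eq (by ring)) ?_
        rw [← heq]; gcongr
      _ = _ := by ring

/-- A perturbed Euler scheme that stays in a compact set follows the solutions. -/
lemma tendsto_solution_of_perturbed {f : V → V} {U C : Set V} (hf : LocallyLipschitzOn U f)
    (hC : IsCompact C) (hCU : C ⊆ U) {β : ℕ → ℝ} (hβ : ∀ n, 0 < β n)
    (hβ0 : Tendsto β atTop (𝓝 0)) {x y w : ℕ → V} (hy : ∀ n, y (n + 1) = y n + β n • w n)
    (hw : Tendsto (fun n => w n - f (x n)) atTop (𝓝 0))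
    (hxy : Tendsto (fun n => x n - y n) atTop (𝓝 0)) (hxC : ∀ᶠ n in atTop, x n ∈ C)
    {γ : ℝ → V} (hγ : IsForwardSolution f U γ) {ι : Type*} {l : Filter ι} {n m : ι → ℕ}
    (hn : Tendsto n l atTop) (hnm : ∀ i, n i ≤ m i) {T : ℝ} (hT : 0 ≤ T)
    (ht : Tendsto (fun i => stepTime β (m i) - stepTime β (n i)) l (𝓝 T))
    (hx0 : Tendsto (fun i => x (n i)) l (𝓝 (γ 0))) :
    Tendsto (fun i => x (m i)) l (𝓝 (γ T)) := by
  -- One compact set for both the iterates and the solution. The extra unit of time leaves room for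
  -- elapsed times that only tend to T.
  set E := C ∪ γ '' Icc 0 (T + 1) with hEdef
  have hEc : IsCompact E := hC.union (isCompact_Icc.image_of_continuousOn
    (hγ.continuousOn.mono fun t ht => ht.1))
  have hEU : E ⊆ U := union_subset hCU (by rintro _ ⟨t, ht, rfl⟩; exact hγ.2 t ht.1)
  obtain ⟨L, hL⟩ := (hf.mono hEU).exists_lipschitzOnWith_of_compact hEc
  obtain ⟨M, hM⟩ := hEc.exists_bound_of_continuousOn hL.continuousOn
  have hm : Tendsto m l atTop := tendsto_atTop_mono hnm hn
  have hγE : ∀ t ∈ Icc 0 (T + 1), γ t ∈ E := fun t ht => Or.inr ⟨t, ht, rfl⟩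
  have herr : Tendsto (fun j => ‖w j - f (x j)‖ + L * ‖x j - y j‖ + L * M * β j) atTop (𝓝 0) := by
    have := (hw.norm.add (hxy.norm.const_mul (L : ℝ))).add (hβ0.const_mul (L * M))
    simpa using this
  have hy0 : Tendsto (fun i => ‖y (n i) - γ 0‖) l (𝓝 0) := by
    have := hx0.sub (hxy.comp hn)
    rw [← tendsto_iff_norm_sub_tendsto_zero]
    simpa using this
  have htr : Tendsto (fun i => y (m i) - γ (stepTime β (m i) - stepTime β (n i))) l (𝓝 0) := by
    rw [Metric.tendsto_nhds]
    intro ε hε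
    set Q := Real.exp (L * (T + 1)) with hQ
    have hQ0 : 0 < Q := Real.exp_pos _
    set η := ε / (2 * (T + 1) * Q) with hη
    have hη0 : 0 < η := by positivity
    have hηQ : η * (T + 1) * Q = ε / 2 := by rw [hη]; field_simp
    obtain ⟨N, hN⟩ := eventually_atTop.1 ((herr.eventually_lt_const hη0).and hxC)
    filter_upwards [hn.eventually_ge_atTop N, ht.eventually_lt_const (lt_add_one T),
      hy0.eventually_lt_const (show 0 < ε / (2 * Q) by positivity)] with i h1 h2 h3
    have hs0 : 0 ≤ stepTime β (m i) - stepTime β (n i) :=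
      sub_nonneg.2 (stepTime_mono hβ (hnm i))
    have := norm_sub_solution_le hγ hL hM hβ hy hγE
      (fun j hj => Or.inl (hN j (h1.trans hj)).2) (fun j hj => (hN j (h1.trans hj)).1.le)
      (hnm i) h2.le
    rw [dist_zero_right]
    calc _ ≤ _ := this
      _ ≤ (‖y (n i) - γ 0‖ + η * (T + 1)) * Q := by rw [hQ]; gcongr
      _ = ‖y (n i) - γ 0‖ * Q + ε / 2 := by rw [add_mul, hηQ]
      _ < ε / (2 * Q) * Q + ε / 2 := by gcongr
      _ = ε := by field_simp; ring
  have hγt : Tendsto (fun i => γ (stepTime β (m i) - stepTime β (n i))) l (𝓝 (γ T)) :=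
    (hγ.continuousOn T hT).tendsto.comp (tendsto_nhdsWithin_iff.2
      ⟨ht, Eventually.of_forall fun i => sub_nonneg.2 (stepTime_mono hβ (hnm i))⟩)
  simpa using (htr.add hγt).add (hxy.comp hm)

/-- A perturbed Euler scheme that stays in a compact subset of the domain of attraction of an
asymptotically stable equilibrium converges to it. -/
theorem tendsto_of_perturbed_of_basin {f : V → V} {U C : Set V} (hf : LocallyLipschitzOn U f)
    {z : V} (hz : IsAsymptoticallyStable f U z) (hC : IsCompact C)
    (hCB : C ⊆ basinOfAttraction f U z) {β : ℕ → ℝ} (hβ : ∀ n, 0 < β n)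
    (hβ0 : Tendsto β atTop (𝓝 0)) (hsum : ¬ Summable β) {x y w : ℕ → V}
    (hy : ∀ n, y (n + 1) = y n + β n • w n)
    (hw : Tendsto (fun n => w n - f (x n)) atTop (𝓝 0))
    (hxy : Tendsto (fun n => x n - y n) atTop (𝓝 0)) (hxC : ∀ᶠ n in atTop, x n ∈ C) :
    Tendsto x atTop (𝓝 z) := by
  have hCU : C ⊆ U := fun u hu => by
    obtain ⟨⟨γ, hγ, rfl⟩, -⟩ := hCB hu
    exact hγ.2 0 le_rfl
  -- The limit set of the iterates. The aim is to show that it contains no point other than z.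
  set Λ : Set V := {u | MapClusterPt u atTop x} with hΛ
  have hΛclosed : IsClosed Λ := isClosed_setOfPred_clusterPt
  have hΛC : Λ ⊆ C := fun u hu => hC.isClosed.mem_of_mapClusterPt hu hxC
  have hΛc : IsCompact Λ := hC.of_isClosed_subset hΛclosed hΛC
  -- Forward invariance: along indices where the iterates tend to γ 0, the iterates a time T later
  -- tend to γ T.
  have hfwd : ∀ γ, IsForwardSolution f U γ → γ 0 ∈ Λ → ∀ T, 0 ≤ T → γ T ∈ Λ := by
    intro γ hγ h0 T hT
    obtain ⟨ψ, hψ, hψx⟩ := MapClusterPt.tendsto_subseq h0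
    choose m hm1 hm2 hm3 using fun k => exists_stepTime_after hβ hsum (ψ k) hT
    have ht : Tendsto (fun k => stepTime β (m k) - stepTime β (ψ k)) atTop (𝓝 T) := by
      rw [Metric.tendsto_atTop]
      intro ε hε
      obtain ⟨N, hN⟩ := eventually_atTop.1 (hβ0.eventually_lt_const (half_pos hε))
      refine ⟨N, fun k hk => ?_⟩
      have := hm3 k (ε / 2) fun j hj => (hN j (hk.trans ((hψ.id_le k).trans hj))).le
      rw [Real.dist_eq, abs_of_nonneg (by linarith [hm2 k])]
      linarith
    have := tendsto_solution_of_perturbed hf hC hCU hβ hβ0 hy hw hxy hxC hγ hψ.tendsto_atTop hm1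
      hT ht hψx
    exact MapClusterPt.of_comp (tendsto_atTop_mono hm1 hψ.tendsto_atTop) this.mapClusterPt
  -- Backward invariance: go back a time T from indices where the iterates tend to u, extract a
  -- limit by compactness, and follow a solution from it.
  have hbwd : ∀ u ∈ Λ, ∀ T, 0 ≤ T → ∃ γ, IsForwardSolution f U γ ∧ γ 0 ∈ Λ ∧ γ T = u := by
    intro u hu T hT
    obtain ⟨ψ, hψ, hψx⟩ := MapClusterPt.tendsto_subseq hu
    have hτ := tendsto_stepTime hβ hsum
    obtain ⟨B, hB⟩ := hβ0.bddAbove_range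
    have hψτ := hτ.comp hψ.tendsto_atTop
    have hpick : ∀ k, ∃ n, n ≤ ψ k ∧ (T ≤ stepTime β (ψ k) →
        T ≤ stepTime β (ψ k) - stepTime β n ∧
          (n = ψ k ∨ stepTime β (ψ k) - stepTime β n ≤ T + β n)) := fun k => by
      by_cases h : T ≤ stepTime β (ψ k)
      · obtain ⟨n, h1, h2, h3⟩ := exists_stepTime_before h
        exact ⟨n, h1, fun _ => ⟨h2, h3⟩⟩
      · exact ⟨0, Nat.zero_le _, fun h' => absurd h' h⟩
    choose n hn1 hn2 using hpick
    have hle : ∀ᶠ k in atTop, T ≤ stepTime β (ψ k) - stepTime β (n k) ∧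
        stepTime β (ψ k) - stepTime β (n k) ≤ T + β (n k) := by
      filter_upwards [hψτ.eventually_ge_atTop T] with k hk
      obtain ⟨h2, h3⟩ := hn2 k hk
      refine ⟨h2, h3.elim (fun h => ?_) id⟩
      rw [h]; linarith [hβ (ψ k)]
    -- Going back costs at most T + sup β of clock time, so the earlier indices escape to infinity
    -- too.
    have hn : Tendsto n atTop atTop := by
      refine tendsto_atTop.2 fun N => ?_
      filter_upwards [hle, hψτ.eventually_gt_atTop (T + B + stepTime β N)] with k h1 h2
      by_contra! h
      have := stepTime_mono hβ h.le
      have := hB ⟨n k, rfl⟩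
      simp only [Function.comp] at h2
      linarith [h1.2]
    have ht : Tendsto (fun k => stepTime β (ψ k) - stepTime β (n k)) atTop (𝓝 T) := by
      refine tendsto_of_tendsto_of_tendsto_of_le_of_le' tendsto_const_nhds
        (h := fun k => T + β (n k)) ?_ (hle.mono fun k h => h.1) (hle.mono fun k h => h.2)
      simpa using (hβ0.comp hn).const_add T
    obtain ⟨v, -, φ, hφ, hφv⟩ := hC.tendsto_subseq' (hn.eventually hxC).frequently
    have hnφ := hn.comp hφ.tendsto_atTop
    have hvΛ : v ∈ Λ := MapClusterPt.of_comp hnφ hφv.mapClusterPt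
    obtain ⟨⟨γ, hγ, rfl⟩, -⟩ := hCB (hΛC hvΛ)
    refine ⟨γ, hγ, hvΛ, ?_⟩
    have := tendsto_solution_of_perturbed hf hC hCU hβ hβ0 hy hw hxy hxC hγ hnφ
      (fun k => hn1 (φ k)) hT (ht.comp hφ.tendsto_atTop) hφv
    exact tendsto_nhds_unique this (hψx.comp hφ.tendsto_atTop)
  obtain ⟨L, hL⟩ := (hf.mono hCU).exists_lipschitzOnWith_of_compact hC
  refine hC.tendsto_nhds_of_unique_mapClusterPt hxC fun u _ hu => ?_
  -- The limit point u is reached from the limit set after arbitrarily long times k. A cluster point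
  -- v of the starting points lies in the domain of attraction, so the solution from v is within δ/2
  -- of z at some time T.
  choose γ hγ hγ0 hγu using fun k : ℕ => hbwd u hu k k.cast_nonneg
  obtain ⟨v, hv, ψ, hψ, hψv⟩ := hΛc.tendsto_subseq hγ0
  obtain ⟨⟨g, hg, rfl⟩, hgz⟩ := hCB (hΛC hv)
  refine eq_of_forall_dist_le fun ε hε => ?_
  obtain ⟨δ, hδ, hstab⟩ := hz.stable ε hε
  obtain ⟨T, hT, hT0⟩ := (((Metric.tendsto_nhds.1 (hgz g hg rfl)) (δ / 2) (half_pos hδ)).and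
    (eventually_ge_atTop 0)).exists
  have hclose : Tendsto (fun k => dist (γ (ψ k) 0) (g 0) * Real.exp (L * (T - 0))) atTop (𝓝 0) := by
    simpa using (tendsto_iff_dist_tendsto_zero.1 hψv).mul_const (Real.exp (L * (T - 0)))
  obtain ⟨k, hk, hkT⟩ := ((hclose.eventually_lt_const (half_pos hδ)).and
    ((tendsto_natCast_atTop_atTop.comp hψ.tendsto_atTop).eventually_ge_atTop T)).exists
  -- Grönwall comparison up to time T. It needs one Lipschitz constant along both trajectories, and
  -- forward invariance supplies it by keeping them in C.
  have hd := dist_le_of_trajectories_ODE_of_mem (v := fun _ => f) (s := fun _ => C) (K := L)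
    (a := 0) (b := T) (fun _ _ => hL)
    ((hγ (ψ k)).continuousOn.mono fun t ht => ht.1)
    (fun t ht => (hγ (ψ k)).hasDerivWithinAt_Ici ht.1)
    (fun t ht => hΛC (hfwd _ (hγ (ψ k)) (hγ0 _) t ht.1))
    (hg.continuousOn.mono fun t ht => ht.1) (fun t ht => hg.hasDerivWithinAt_Ici ht.1)
    (fun t ht => hΛC (hfwd _ hg hv t ht.1)) le_rfl T ⟨hT0, le_rfl⟩
  -- Restarted at time T, the solution begins within δ of z, hence stays within ε; after the
  -- remaining time k - T it is at u.
  have hfin := hstab _ ((hγ (ψ k)).shift hT0)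
    (by
      rw [zero_add]
      linarith [dist_triangle (γ (ψ k) T) (g T) z]) ((ψ k : ℝ) - T) (sub_nonneg.2 hkT)
  rw [sub_add_cancel, hγu] at hfin
  exact hfin.le

end Tracking

/-! ### Affine dissipative vector fields depending on a parameter -/

/-- Once η is below κε/2, the excess of a over ε/2 is multiplied by at most 1 - κα ≤ exp(-κα) per
step, and the exponents add up to -∞. -/
lemma tendsto_zero_of_linear_recursion {α a η : ℕ → ℝ} {κ : ℝ} (hκ : 0 < κ)
    (hα : ∀ n, 0 < α n) (hα0 : Tendsto α atTop (𝓝 0)) (hsum : ¬ Summable α)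
    (hη : Tendsto η atTop (𝓝 0)) (ha : ∀ n, 0 ≤ a n)
    (hrec : ∀ᶠ n in atTop, a (n + 1) ≤ (1 - κ * α n) * a n + α n * η n) :
    Tendsto a atTop (𝓝 0) := by
  rw [Metric.tendsto_nhds]
  intro ε hε
  have h1 : ∀ᶠ n in atTop, κ * α n < 1 :=
    (by simpa using hα0.const_mul κ : Tendsto (fun n => κ * α n) atTop (𝓝 0)).eventually_lt_const
      one_pos
  obtain ⟨N, hN⟩ := eventually_atTop.1
    ((hrec.and h1).and (hη.eventually_lt_const (show 0 < κ * (ε / 2) by positivity)))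
  -- The absolute value keeps the bound nonnegative even if the initial excess is negative, so that
  -- 1 - κα may be replaced by the larger exponential factor.
  have hind : ∀ n, N ≤ n →
      a n - ε / 2 ≤ |a N - ε / 2| * Real.exp (-(κ * (stepTime α n - stepTime α N))) := by
    intro n hn
    induction n, hn using Nat.le_induction with
    | base => simpa using le_abs_self (a N - ε / 2)
    | succ n hn ih =>
      obtain ⟨⟨hr, hk⟩, he⟩ := hN n hn
      have hαn := hα n
      have hexp : Real.exp (-(κ * (stepTime α (n + 1) - stepTime α N))) =
          Real.exp (-(κ * α n)) * Real.exp (-(κ * (stepTime α n - stepTime α N))) := by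
        rw [stepTime_succ, ← Real.exp_add]; ring_nf
      have hle : 1 - κ * α n ≤ Real.exp (-(κ * α n)) := by
        linarith [Real.add_one_le_exp (-(κ * α n))]
      have hstep : a (n + 1) - ε / 2 ≤ (1 - κ * α n) * (a n - ε / 2) := by nlinarith
      calc _ ≤ _ := hstep
        _ ≤ (1 - κ * α n) *
            (|a N - ε / 2| * Real.exp (-(κ * (stepTime α n - stepTime α N)))) := by
          gcongr
        _ ≤ Real.exp (-(κ * α n)) *
            (|a N - ε / 2| * Real.exp (-(κ * (stepTime α n - stepTime α N)))) := by gcongr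
        _ = _ := by rw [hexp]; ring
  have hlim : Tendsto (fun n => |a N - ε / 2| * Real.exp (-(κ * (stepTime α n - stepTime α N))))
      atTop (𝓝 0) := by
    have : Tendsto (fun n => κ * (stepTime α n - stepTime α N)) atTop atTop :=
      (tendsto_atTop_add_const_right _ _ (tendsto_stepTime hα hsum)).const_mul_atTop hκ
    simpa using (Real.tendsto_exp_neg_atTop_nhds_zero.comp this).const_mul |a N - ε / 2|
  filter_upwards [hlim.eventually_lt_const (half_pos hε), eventually_ge_atTop N] with n h2 h3
  rw [dist_zero_right, Real.norm_of_nonneg (ha n)]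
  linarith [hind n h3]

section AffineDissipative

open scoped RealInnerProductSpace

variable {E F : Type*} [NormedAddCommGroup E]
  [NormedAddCommGroup F] [InnerProductSpace ℝ F]

/-- A family `θ ↦ h x θ` of affine vector fields, locally Lipschitz in all variables for `x ∈ D`,
whose linear parts `-G x` are dissipative. -/
structure IsAffineDissipativeOn (D : Set E) (h : E → F → F) (G : E → F →L[ℝ] F) : Prop where
  affine : ∀ x θ, h x θ = h x 0 - G x θ
  pos : ∀ x ∈ D, ∀ u, u ≠ 0 → 0 < ⟪u, G x u⟫
  lipschitz : LocallyLipschitzOn (D ×ˢ (univ : Set F)) fun p => h p.1 p.2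

namespace IsAffineDissipativeOn

variable {D : Set E} {h : E → F → F} {G : E → F →L[ℝ] F}

lemma sub_eq (H : IsAffineDissipativeOn D h G) (x : E) (θ θ' : F) :
    h x θ - h x θ' = -G x (θ - θ') := by
  rw [H.affine x θ, H.affine x θ', map_sub]; abel

/-- Since G x u = h x 0 - h x u, joint continuity comes from h; nothing is assumed on how G depends
on x. -/
lemma continuousOn_apply (H : IsAffineDissipativeOn D h G) :
    ContinuousOn (fun p : E × F => G p.1 p.2) (D ×ˢ univ) := by
  have h1 := H.lipschitz.continuousOn
  have h2 : ContinuousOn (fun p : E × F => h p.1 0) (D ×ˢ univ) :=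
    h1.comp (f := fun p : E × F => (p.1, (0 : F))) (by fun_prop) fun p hp => ⟨hp.1, trivial⟩
  refine (h2.sub h1).congr fun p _ => ?_
  rw [Pi.sub_apply, H.affine p.1 p.2]; simp

/-- Expanding the square gives the factor 1 - 2aκ + a²g² ≤ 1 - aκ ≤ (1 - aκ/2)². The bound a g² ≤ κ
absorbs the quadratic term, and aκ ≤ 2 keeps the root nonnegative. -/
lemma norm_sub_smul_le {T : F →L[ℝ] F} {κ g a : ℝ} (hT : ∀ u, κ * ‖u‖ ^ 2 ≤ ⟪u, T u⟫)
    (hg : ∀ u, ‖T u‖ ≤ g * ‖u‖) (ha : 0 ≤ a) (h1 : a * g ^ 2 ≤ κ) (h2 : a * κ ≤ 2) (u : F) :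
    ‖u - a • T u‖ ≤ (1 - κ / 2 * a) * ‖u‖ := by
  refine le_of_sq_le_sq ?_ (mul_nonneg (by linarith) (norm_nonneg _))
  rw [norm_sub_sq_real, inner_smul_right, norm_smul, Real.norm_of_nonneg ha]
  have h3 : ‖T u‖ ^ 2 ≤ g ^ 2 * ‖u‖ ^ 2 := by
    rw [← mul_pow]; exact pow_le_pow_left₀ (norm_nonneg _) (hg u) 2
  have h4 := mul_le_mul_of_nonneg_left (hT u) ha
  have h5 := mul_le_mul_of_nonneg_left h3 (sq_nonneg a)
  have h6 := mul_le_mul_of_nonneg_right h1 (mul_nonneg ha (sq_nonneg ‖u‖))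
  have h7 := sq_nonneg (κ * a * ‖u‖)
  nlinarith

variable [FiniteDimensional ℝ F]

/-- A positive continuous function has a positive lower bound on C times the unit sphere;
homogeneity extends it to all u. -/
lemma exists_pos_le_inner (H : IsAffineDissipativeOn D h G) {C : Set E} (hC : IsCompact C)
    (hCD : C ⊆ D) : ∃ κ > 0, ∀ x ∈ C, ∀ u, κ * ‖u‖ ^ 2 ≤ ⟪u, G x u⟫ := by
  have := FiniteDimensional.proper_real F
  have hcont : ContinuousOn (fun p : E × F => ⟪p.2, G p.1 p.2⟫) (C ×ˢ Metric.sphere 0 1) :=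
    continuousOn_snd.inner (H.continuousOn_apply.mono (prod_mono hCD (subset_univ _)))
  obtain ⟨κ, hκ, hle⟩ := (hC.prod (isCompact_sphere (0 : F) 1)).exists_forall_le' hcont
    (a := 0) fun p hp => H.pos _ (hCD hp.1) _ (ne_zero_of_mem_unit_sphere ⟨p.2, hp.2⟩)
  refine ⟨κ, hκ, fun x hx u => ?_⟩
  rcases eq_or_ne u 0 with rfl | hu
  · simp
  have hn : ‖u‖ ≠ 0 := norm_ne_zero_iff.2 hu
  have := hle (x, ‖u‖⁻¹ • u) ⟨hx, by simp [norm_smul, hn]⟩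
  simp only [map_smul, inner_smul_left, inner_smul_right, RCLike.conj_to_real] at this
  have h2 := mul_le_mul_of_nonneg_right this (sq_nonneg ‖u‖)
  calc _ ≤ _ := h2
    _ = _ := by field_simp

lemma exists_norm_apply_le (H : IsAffineDissipativeOn D h G) {C : Set E} (hC : IsCompact C)
    (hCD : C ⊆ D) : ∃ g, 0 ≤ g ∧ ∀ x ∈ C, ∀ u, ‖G x u‖ ≤ g * ‖u‖ := by
  have := FiniteDimensional.proper_real F
  obtain ⟨g, hg⟩ := (hC.prod (isCompact_sphere (0 : F) 1)).exists_bound_of_continuousOn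
    (H.continuousOn_apply.mono (prod_mono hCD (subset_univ _)))
  refine ⟨max g 0, le_max_right _ _, fun x hx u => ?_⟩
  rcases eq_or_ne u 0 with rfl | hu
  · simp
  have hn : ‖u‖ ≠ 0 := norm_ne_zero_iff.2 hu
  have := (hg (x, ‖u‖⁻¹ • u) ⟨hx, by simp [norm_smul, hn]⟩).trans (le_max_left g 0)
  simp only [map_smul, norm_smul, norm_inv, norm_norm] at this
  rwa [inv_mul_le_iff₀ (by positivity), mul_comm] at this

/-- Positivity makes G x injective, hence surjective in finite dimension, so G x θ = h x 0 can be
solved. Off D the value is irrelevant. -/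
lemma exists_equilibrium (H : IsAffineDissipativeOn D h G) :
    ∃ Λ : E → F, ∀ x ∈ D, h x (Λ x) = 0 := by
  have : ∀ x, ∃ θ, x ∈ D → h x θ = 0 := fun x => by
    by_cases hx : x ∈ D
    · have hinj : Function.Injective (G x : F →ₗ[ℝ] F) := by
        rw [← LinearMap.ker_eq_bot, LinearMap.ker_eq_bot']
        intro u hu
        by_contra hne
        have := H.pos x hx u hne
        rw [ContinuousLinearMap.coe_coe] at hu
        simp [hu] at this
      obtain ⟨θ, hθ⟩ := (LinearMap.injective_iff_surjective.1 hinj) (h x 0)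
      rw [ContinuousLinearMap.coe_coe] at hθ
      exact ⟨θ, fun _ => by rw [H.affine, hθ, sub_self]⟩
    · exact ⟨0, fun h' => absurd h' hx⟩
  choose Λ hΛ using this
  exact ⟨Λ, hΛ⟩

variable {Λ : E → F}

omit [FiniteDimensional ℝ F] in
lemma eq_neg_apply (H : IsAffineDissipativeOn D h G) (hΛ : ∀ x ∈ D, h x (Λ x) = 0) {x : E}
    (hx : x ∈ D) (θ : F) : h x θ = -G x (θ - Λ x) := by
  rw [← H.sub_eq, hΛ x hx, sub_zero]

omit [FiniteDimensional ℝ F] in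
-- Coercivity and Cauchy–Schwarz applied to h x θ = G x (Λ x - θ). With θ = Λ x' this compares
-- equilibria at two parameters.
lemma norm_equilibrium_sub_le (H : IsAffineDissipativeOn D h G) (hΛ : ∀ x ∈ D, h x (Λ x) = 0)
    {x : E} (hx : x ∈ D) {κ : ℝ} (hκ : 0 < κ) (hG : ∀ u, κ * ‖u‖ ^ 2 ≤ ⟪u, G x u⟫) (θ : F) :
    ‖Λ x - θ‖ ≤ κ⁻¹ * ‖h x θ‖ := by
  have h1 : h x θ = G x (Λ x - θ) := by
    rw [H.eq_neg_apply hΛ hx, ← map_neg, neg_sub]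
  have h2 := (hG (Λ x - θ)).trans (real_inner_le_norm _ _)
  rw [← h1] at h2
  rw [← div_eq_inv_mul, le_div_iff₀ hκ]
  rcases (norm_nonneg (Λ x - θ)).eq_or_lt with h3 | h3
  · rw [← h3]; simp
  · refine le_of_mul_le_mul_left ?_ h3
    linarith

/-- Along every solution exp(2κt)‖γ t - Λ x‖² is nonincreasing. The resulting exponential decay
gives attraction, and stability with δ = ε. -/
lemma isGloballyAsymptoticallyStable (H : IsAffineDissipativeOn D h G)
    (hΛ : ∀ x ∈ D, h x (Λ x) = 0) {x : E} (hx : x ∈ D) :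
    IsGloballyAsymptoticallyStable (h x) (Λ x) := by
  obtain ⟨κ, hκ, hG⟩ := H.exists_pos_le_inner isCompact_singleton (singleton_subset_iff.2 hx)
  replace hG := hG x rfl
  have hdecay : ∀ γ, IsForwardSolution (h x) univ γ → ∀ t, 0 ≤ t →
      ‖γ t - Λ x‖ ≤ ‖γ 0 - Λ x‖ * Real.exp (-(κ * t)) := by
    intro γ hγ t ht
    have hder : ∀ s ∈ Ici (0 : ℝ), HasDerivWithinAt
        (fun s => Real.exp (2 * κ * s) * ‖γ s - Λ x‖ ^ 2)
        (Real.exp (2 * κ * s) * (2 * κ) * ‖γ s - Λ x‖ ^ 2 +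
          Real.exp (2 * κ * s) * (2 * ⟪γ s - Λ x, h x (γ s)⟫)) (Ici 0) s := fun s hs => by
      have h1 : HasDerivAt (fun s => Real.exp (2 * κ * s)) (Real.exp (2 * κ * s) * (2 * κ)) s := by
        simpa using ((hasDerivAt_id s).const_mul (2 * κ)).exp
      exact h1.hasDerivWithinAt.mul ((hγ.1 s hs).sub_const (Λ x)).norm_sq
    have hanti : AntitoneOn (fun s => Real.exp (2 * κ * s) * ‖γ s - Λ x‖ ^ 2) (Ici 0) := by
      refine antitoneOn_of_hasDerivWithinAt_nonpos (convex_Ici 0)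
        (fun s hs => (hder s hs).continuousWithinAt)
        (fun s hs => (hder s (interior_subset hs)).mono interior_subset) fun s hs => ?_
      rw [H.eq_neg_apply hΛ hx, inner_neg_right]
      have := hG (γ s - Λ x)
      have := Real.exp_pos (2 * κ * s)
      nlinarith
    have h2 := hanti (mem_Ici.2 le_rfl) (mem_Ici.2 ht) ht
    simp only [mul_zero, Real.exp_zero, one_mul] at h2
    refine le_of_sq_le_sq ?_ (by positivity)
    have h3 : Real.exp (-(κ * t)) ^ 2 = (Real.exp (2 * κ * t))⁻¹ := by
      rw [← Real.exp_neg, ← Real.exp_nat_mul]; congr 1; push_cast; ring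
    rw [mul_pow, h3, ← div_eq_mul_inv, le_div_iff₀ (Real.exp_pos _)]
    linarith
  have hbasin : basinOfAttraction (h x) univ (Λ x) = univ := by
    refine eq_univ_of_forall fun θ => ⟨?_, fun γ hγ _ => ?_⟩
    -- Existence from every initial point, by the explicit solution of the affine equation.
    · refine ⟨fun t => Λ x + NormedSpace.exp (t • (-G x)) (θ - Λ x),
        ⟨fun t _ => ?_, fun _ _ => trivial⟩, by simp⟩
      have h1 := (hasDerivAt_exp_smul_const' (𝕂 := ℝ) (-G x) t).clm_apply
        (hasDerivAt_const t (θ - Λ x))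
      refine ((h1.const_add (Λ x)).congr_deriv ?_).hasDerivWithinAt
      simp [H.eq_neg_apply hΛ hx]
    · rw [tendsto_iff_norm_sub_tendsto_zero]
      have h0 : Tendsto (fun t => ‖γ 0 - Λ x‖ * Real.exp (-(κ * t))) atTop (𝓝 0) := by
        simpa using (Real.tendsto_exp_neg_atTop_nhds_zero.comp
          (tendsto_id.const_mul_atTop hκ)).const_mul ‖γ 0 - Λ x‖
      exact squeeze_zero' (Eventually.of_forall fun _ => norm_nonneg _)
        ((eventually_ge_atTop 0).mono fun t ht => hdecay γ hγ t ht) h0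
  refine ⟨⟨trivial, hΛ x hx, fun ε hε => ⟨ε, hε, fun γ hγ h0 t ht => ?_⟩,
    by rw [hbasin]; exact univ_mem⟩, hbasin⟩
  rw [dist_eq_norm] at h0 ⊢
  refine ((hdecay γ hγ t ht).trans (mul_le_of_le_one_right (norm_nonneg _) ?_)).trans_lt h0
  exact Real.exp_le_one_iff.2 (by simpa using mul_nonneg hκ.le ht)

variable [NormedSpace ℝ E] [FiniteDimensional ℝ E]

/-- As h x' (Λ x') = 0, the residual h x (Λ x') is at most L‖x - x'‖, and `norm_equilibrium_sub_le`
turns residuals into distances. -/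
lemma locallyLipschitzOn_equilibrium (H : IsAffineDissipativeOn D h G) (hD : IsOpen D)
    (hΛ : ∀ x ∈ D, h x (Λ x) = 0) : LocallyLipschitzOn D Λ := by
  have := FiniteDimensional.proper_real E
  intro x₀ hx₀
  obtain ⟨C, hC, hx₀C, hCD⟩ := exists_compact_subset hD hx₀
  obtain ⟨κ, hκ, hG⟩ := H.exists_pos_le_inner hC hCD
  obtain ⟨L, t, ht, hL⟩ := H.lipschitz (x := (x₀, Λ x₀)) ⟨hx₀, trivial⟩
  rw [(hD.prod isOpen_univ).nhdsWithin_eq (show (x₀, Λ x₀) ∈ D ×ˢ univ from ⟨hx₀, trivial⟩)] at ht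
  obtain ⟨u, hu, v, hv, huv⟩ := mem_nhds_prod_iff.1 ht
  have hCn : C ∈ 𝓝 x₀ := mem_interior_iff_mem_nhds.1 hx₀C
  have key : ∀ x ∈ u ∩ C, ∀ x' ∈ u ∩ C, Λ x' ∈ v →
      ‖Λ x - Λ x'‖ ≤ κ⁻¹ * (L * ‖x - x'‖) := fun x hx x' hx' hv' => by
    refine (H.norm_equilibrium_sub_le hΛ (hCD hx.2) hκ (hG x hx.2) (Λ x')).trans ?_
    gcongr
    have := hL.dist_le_mul (x, Λ x') (huv ⟨hx.1, hv'⟩) (x', Λ x') (huv ⟨hx'.1, hv'⟩)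
    simp only [hΛ x' (hCD hx'.2), dist_zero_right, Prod.dist_eq, dist_self] at this
    rwa [max_eq_left dist_nonneg, dist_eq_norm] at this
  -- The estimate with x' = x₀ comes first: it gives continuity at x₀, which places nearby values of
  -- Λ in the neighbourhood v where h is Lipschitz.
  have hcont : Tendsto Λ (𝓝 x₀) (𝓝 (Λ x₀)) := by
    rw [tendsto_iff_norm_sub_tendsto_zero]
    have h0 : Tendsto (fun x => κ⁻¹ * (L * ‖x - x₀‖)) (𝓝 x₀) (𝓝 0) :=
      Continuous.tendsto' (by fun_prop) _ _ (by simp)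
    refine squeeze_zero' (Eventually.of_forall fun _ => norm_nonneg _) ?_ h0
    filter_upwards [inter_mem hu hCn] with x hx
    exact key x hx x₀ ⟨mem_of_mem_nhds hu, mem_of_mem_nhds hCn⟩ (mem_of_mem_nhds hv)
  refine ⟨⟨κ⁻¹ * L, by positivity⟩, u ∩ C ∩ Λ ⁻¹' v,
    mem_nhdsWithin_of_mem_nhds (inter_mem (inter_mem hu hCn) (hcont hv)),
    LipschitzOnWith.of_dist_le_mul fun x hx x' hx' => ?_⟩
  rw [dist_eq_norm, dist_eq_norm]
  refine (key x hx.1 x' hx'.1 hx'.2).trans (le_of_eq ?_)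
  rw [← mul_assoc]; rfl

/-- The fast iterates of a two-timescale recursion track the equilibrium. -/
theorem tendsto_sub_equilibrium (H : IsAffineDissipativeOn D h G) (hD : IsOpen D)
    (hΛ : ∀ x ∈ D, h x (Λ x) = 0) {α β : ℕ → ℝ} (hα : ∀ n, 0 < α n) (hβ : ∀ n, 0 < β n)
    (hα0 : Tendsto α atTop (𝓝 0)) (hsum : ¬ Summable α)
    (hratio : Tendsto (fun n => β n / α n) atTop (𝓝 0)) {C : Set E} (hC : IsCompact C)
    (hCD : C ⊆ D) {ξ ζ v : ℕ → E} {θ y : ℕ → F} (hξC : ∀ᶠ n in atTop, ξ n ∈ C)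
    (hζ : ∀ n, ζ (n + 1) = ζ n + β n • v n) {B : ℝ} (hv : ∀ᶠ n in atTop, ‖v n‖ ≤ B)
    (hξζ : Tendsto (fun n => ξ n - ζ n) atTop (𝓝 0))
    (hy : ∀ n, y (n + 1) = y n + α n • h (ξ n) (θ n))
    (hθy : Tendsto (fun n => θ n - y n) atTop (𝓝 0)) :
    Tendsto (fun n => θ n - Λ (ξ n)) atTop (𝓝 0) := by
  have := FiniteDimensional.proper_real E
  -- The noise-free iterates ζ are only close to C, so the Lipschitz constant of Λ is taken on a
  -- compact neighbourhood inside D.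
  obtain ⟨δ, hδ, hδD⟩ := hC.exists_cthickening_subset_open hD hCD
  have hKc : IsCompact (Metric.cthickening δ C) := hC.cthickening
  have hCK := Metric.self_subset_cthickening (δ := δ) C
  obtain ⟨κ, hκ, hG⟩ := H.exists_pos_le_inner hC hCD
  obtain ⟨g, hg0, hg⟩ := H.exists_norm_apply_le hC hCD
  obtain ⟨L, hL⟩ :=
    ((H.locallyLipschitzOn_equilibrium hD hΛ).mono hδD).exists_lipschitzOnWith_of_compact hKc
  have hd : Tendsto (fun n => dist (ξ n) (ζ n)) atTop (𝓝 0) := by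
    simpa [dist_eq_norm] using hξζ.norm
  have hζK : ∀ᶠ n in atTop, ζ n ∈ Metric.cthickening δ C := by
    filter_upwards [hξC, hd.eventually_lt_const hδ] with n h1 h2
    exact Metric.mem_cthickening_of_dist_le _ _ _ _ h1 (by rw [dist_comm]; exact h2.le)
  have hΛd : Tendsto (fun n => Λ (ζ n) - Λ (ξ n)) atTop (𝓝 0) := by
    rw [tendsto_zero_iff_norm_tendsto_zero]
    have h0 : Tendsto (fun n => (L : ℝ) * dist (ξ n) (ζ n)) atTop (𝓝 0) := by
      simpa using hd.const_mul (L : ℝ)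
    refine squeeze_zero' (Eventually.of_forall fun _ => norm_nonneg _) ?_ h0
    filter_upwards [hξC, hζK] with n h1 h2
    rw [← dist_eq_norm, dist_comm (ξ n)]
    exact hL.dist_le_mul _ h2 _ (hCK h1)
  -- Split θ - Λ(ξ) = w + q: the noise-free distance w obeys a contracting recursion, and q already
  -- tends to 0.
  set q : ℕ → F := fun n => θ n - y n + (Λ (ζ n) - Λ (ξ n)) with hq
  have hq0 : Tendsto q atTop (𝓝 0) := by simpa using hθy.add hΛd
  set w : ℕ → F := fun n => y n - Λ (ζ n) with hw
  -- The equilibrium moves by at most L B β per step. In units of α this is L B β/α, which vanishes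
  -- by the separation of time scales.
  have hη : Tendsto (fun n => g * ‖q n‖ + L * B * (β n / α n)) atTop (𝓝 0) := by
    simpa using (hq0.norm.const_mul g).add (hratio.const_mul (L * B))
  have hα1 : ∀ c d : ℝ, 0 < d → ∀ᶠ n in atTop, α n * c ≤ d := fun c d hd => by
    have : Tendsto (fun n => α n * c) atTop (𝓝 0) := by simpa using hα0.mul_const c
    exact (this.eventually_lt_const hd).mono fun _ h => h.le
  have hw0 : Tendsto (fun n => ‖w n‖) atTop (𝓝 0) := by
    refine tendsto_zero_of_linear_recursion (half_pos hκ) hα hα0 hsum hη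
      (fun n => norm_nonneg _) ?_
    filter_upwards [hξC, hζK, (tendsto_add_atTop_nat 1).eventually hζK, hv,
      hα1 (g ^ 2) κ hκ, hα1 κ 2 two_pos] with n h1 h2 h3 h4 h5 h6
    have hαn := hα n
    have hβn := hβ n
    have e1 : θ n - Λ (ξ n) = w n + q n := by simp only [hw, hq]; abel
    have e2 : w (n + 1) = (w n - α n • G (ξ n) (w n)) - α n • G (ξ n) (q n)
        - (Λ (ζ (n + 1)) - Λ (ζ n)) := by
      have : y (n + 1) = y n - α n • (G (ξ n) (w n) + G (ξ n) (q n)) := by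
        rw [hy, H.eq_neg_apply hΛ (hCD h1), e1, map_add, smul_neg, ← sub_eq_add_neg]
      simp only [hw, this, smul_add]; abel
    have e3 : ‖Λ (ζ (n + 1)) - Λ (ζ n)‖ ≤ L * (β n * B) := by
      have := hL.dist_le_mul _ h3 _ h2
      rw [dist_eq_norm, dist_eq_norm, hζ, add_sub_cancel_left, norm_smul,
        Real.norm_of_nonneg hβn.le] at this
      rw [hζ]
      exact this.trans (by gcongr)
    calc ‖w (n + 1)‖ ≤ ‖w n - α n • G (ξ n) (w n)‖ + ‖α n • G (ξ n) (q n)‖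
          + ‖Λ (ζ (n + 1)) - Λ (ζ n)‖ := by
          rw [e2]; exact (norm_sub_le _ _).trans (add_le_add_left (norm_sub_le _ _) _)
      _ ≤ (1 - κ / 2 * α n) * ‖w n‖ + α n * (g * ‖q n‖) + L * (β n * B) := by
          refine add_le_add (add_le_add
            (norm_sub_smul_le (hG _ h1) (hg _ h1) hαn.le h5 h6 _) ?_) e3
          rw [norm_smul, Real.norm_of_nonneg hαn.le]
          gcongr
          exact hg _ h1 _
      _ = _ := by field_simp; ring
  have := (tendsto_zero_iff_norm_tendsto_zero.2 hw0).add hq0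
  rw [add_zero] at this
  refine this.congr fun n => ?_
  simp only [hw, hq]; abel

end IsAffineDissipativeOn

end AffineDissipative

/-! ### Martingale difference noise -/

section Noise

open scoped RealInnerProductSpace

variable {Ω : Type*} {mΩ : MeasurableSpace Ω} {μ : Measure Ω}

lemma integrable_inner_of_sq {F : Type*} [NormedAddCommGroup F] [InnerProductSpace ℝ F]
    {f g : Ω → F} (hf : AEStronglyMeasurable f μ) (hg : AEStronglyMeasurable g μ)
    (hf2 : Integrable (fun ω => ‖f ω‖ ^ 2) μ) (hg2 : Integrable (fun ω => ‖g ω‖ ^ 2) μ) :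
    Integrable (fun ω => ⟪f ω, g ω⟫) μ := by
  refine (hf2.add hg2).mono' (hf.inner hg) (ae_of_all _ fun ω => ?_)
  have := norm_inner_le_norm (𝕜 := ℝ) (f ω) (g ω)
  simp only [Pi.add_apply]
  nlinarith [sq_nonneg (‖f ω‖ - ‖g ω‖), norm_nonneg (f ω), norm_nonneg (g ω)]

/-- Pythagoras' theorem for a martingale increment. -/
lemma integral_norm_add_sq_eq {F : Type*} [NormedAddCommGroup F] [InnerProductSpace ℝ F]
    [CompleteSpace F] {m : MeasurableSpace Ω} (hm : m ≤ mΩ) [IsFiniteMeasure μ] {B M : Ω → F}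
    (hB : StronglyMeasurable[m] B) (hB2 : Integrable (fun ω => ‖B ω‖ ^ 2) μ)
    (hM : Integrable M μ) (hM2 : Integrable (fun ω => ‖M ω‖ ^ 2) μ) (hM0 : μ[M|m] =ᵐ[μ] 0) :
    Integrable (fun ω => ‖B ω + M ω‖ ^ 2) μ ∧
      ∫ ω, ‖B ω + M ω‖ ^ 2 ∂μ = ∫ ω, ‖B ω‖ ^ 2 ∂μ + ∫ ω, ‖M ω‖ ^ 2 ∂μ := by
  have hi : Integrable (fun ω => ⟪B ω, M ω⟫) μ :=
    integrable_inner_of_sq (hB.mono hm).aestronglyMeasurable hM.aestronglyMeasurable hB2 hM2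
  -- Orthogonality: conditioning on m pulls B out and leaves the vanishing conditional mean of M.
  have h0 : ∫ ω, ⟪B ω, M ω⟫ ∂μ = 0 := by
    rw [← integral_condExp hm]
    refine integral_eq_zero_of_ae ?_
    have : μ[fun ω => ⟪B ω, M ω⟫|m] =ᵐ[μ] fun ω => ⟪B ω, (μ[M|m]) ω⟫ :=
      condExp_bilin_of_stronglyMeasurable_left (innerSL ℝ) hB hi hM
    filter_upwards [this, hM0] with ω h1 h2
    simp [h1, h2]
  simp_rw [norm_add_sq_real]
  have h2 : Integrable (fun ω => 2 * ⟪B ω, M ω⟫) μ := hi.const_mul 2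
  have h3 : Integrable (fun ω => ‖B ω‖ ^ 2 + 2 * ⟪B ω, M ω⟫) μ := hB2.add h2
  refine ⟨h3.add hM2, ?_⟩
  rw [integral_add h3 hM2, integral_add hB2 h2, integral_const_mul, h0]
  ring

/-- A real martingale with square-summable increments converges. -/
lemma ae_exists_tendsto_sum_real [IsProbabilityMeasure μ] {ℱ : Filtration ℕ mΩ} {Z : ℕ → Ω → ℝ}
    (hmeas : ∀ n, StronglyMeasurable[ℱ (n + 1)] (Z n)) (hint : ∀ n, Integrable (Z n) μ)
    (hsq : ∀ n, Integrable (fun ω => ‖Z n ω‖ ^ 2) μ) (h0 : ∀ n, μ[Z n|ℱ n] =ᵐ[μ] 0)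
    (hsum : Summable fun n => ∫ ω, ‖Z n ω‖ ^ 2 ∂μ) :
    ∀ᵐ ω ∂μ, ∃ l, Tendsto (fun n => ∑ j ∈ Finset.range n, Z j ω) atTop (𝓝 l) := by
  set S : ℕ → Ω → ℝ := fun n ω => ∑ j ∈ Finset.range n, Z j ω with hS
  have hadapted : StronglyAdapted ℱ S := fun n =>
    Finset.stronglyMeasurable_fun_sum _ fun j hj =>
      (hmeas j).mono (ℱ.mono (Finset.mem_range.1 hj))
  have hSi : ∀ n, Integrable (S n) μ := fun n => integrable_finsetSum _ fun j _ => hint j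
  have hmart : Martingale S ℱ μ := by
    refine martingale_of_condExp_sub_eq_zero_nat hadapted hSi fun n => ?_
    have : S (n + 1) - S n = Z n := by
      ext ω; simp [hS, Finset.sum_range_succ]
    rw [this]; exact h0 n
  have hS2 : ∀ n, Integrable (fun ω => ‖S n ω‖ ^ 2) μ ∧
      ∫ ω, ‖S n ω‖ ^ 2 ∂μ = ∑ j ∈ Finset.range n, ∫ ω, ‖Z j ω‖ ^ 2 ∂μ := by
    intro n
    induction n with
    | zero => simp [hS]
    | succ n ih =>
      have := integral_norm_add_sq_eq (ℱ.le n) (hadapted n) ih.1 (hint n) (hsq n) (h0 n)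
      simp only [hS, Finset.sum_range_succ] at this ih ⊢
      rw [← ih.2]
      exact this
  -- Doob's convergence theorem asks for an L¹ bound; it follows from the L² bound through |S| ≤ 1 +
  -- S².
  set R := 1 + ∑' n, ∫ ω, ‖Z n ω‖ ^ 2 ∂μ with hR
  refine hmart.submartingale.exists_ae_tendsto_of_bdd (R := R.toNNReal) fun n => ?_
  have h1 : ∫ ω, ‖S n ω‖ ∂μ ≤ R := by
    calc ∫ ω, ‖S n ω‖ ∂μ ≤ ∫ ω, (1 + ‖S n ω‖ ^ 2) ∂μ :=
          integral_mono (hSi n).norm ((integrable_const 1).add (hS2 n).1) fun ω => by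
            simp only; nlinarith [sq_nonneg (‖S n ω‖ - 1), norm_nonneg (S n ω)]
      _ = 1 + ∑ j ∈ Finset.range n, ∫ ω, ‖Z j ω‖ ^ 2 ∂μ := by
          rw [integral_add (integrable_const 1) (hS2 n).1, (hS2 n).2]; simp
      _ ≤ R := by
          rw [hR]
          gcongr
          exact hsum.sum_le_tsum _ fun j _ => integral_nonneg fun ω => by positivity
  rw [eLpNorm_one_eq_lintegral_enorm, ← ofReal_integral_norm_eq_lintegral_enorm (hSi n)]
  exact ENNReal.ofReal_le_ofReal h1

variable {V : Type*} [NormedAddCommGroup V] [NormedSpace ℝ V]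

/-- A finite-dimensional martingale with square-summable increments converges. -/
lemma ae_exists_tendsto_sum [FiniteDimensional ℝ V] [CompleteSpace V] [IsProbabilityMeasure μ]
    {ℱ : Filtration ℕ mΩ} {Z : ℕ → Ω → V}
    (hmeas : ∀ n, StronglyMeasurable[ℱ (n + 1)] (Z n)) (hint : ∀ n, Integrable (Z n) μ)
    (hsq : ∀ n, Integrable (fun ω => ‖Z n ω‖ ^ 2) μ) (h0 : ∀ n, μ[Z n|ℱ n] =ᵐ[μ] 0)
    (hsum : Summable fun n => ∫ ω, ‖Z n ω‖ ^ 2 ∂μ) :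
    ∀ᵐ ω ∂μ, ∃ l, Tendsto (fun n => ∑ j ∈ Finset.range n, Z j ω) atTop (𝓝 l) := by
  set b := Module.finBasis ℝ V
  let T : Fin (Module.finrank ℝ V) → V →L[ℝ] ℝ := fun i => (b.coord i).toContinuousLinearMap
  have hcoord : ∀ i, ∀ᵐ ω ∂μ, ∃ l,
      Tendsto (fun n => ∑ j ∈ Finset.range n, T i (Z j ω)) atTop (𝓝 l) := fun i => by
    have hb : ∀ n ω, ‖T i (Z n ω)‖ ^ 2 ≤ ‖T i‖ ^ 2 * ‖Z n ω‖ ^ 2 := fun n ω => by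
      rw [← mul_pow]; exact pow_le_pow_left₀ (norm_nonneg _) ((T i).le_opNorm _) 2
    have hi : ∀ n, Integrable (fun ω => T i (Z n ω)) μ := fun n => (T i).integrable_comp (hint n)
    have hi2 : ∀ n, Integrable (fun ω => ‖T i (Z n ω)‖ ^ 2) μ := fun n =>
      ((hsq n).const_mul (‖T i‖ ^ 2)).mono' ((hi n).aestronglyMeasurable.norm.pow 2)
        (ae_of_all _ fun ω => by simpa using hb n ω)
    refine ae_exists_tendsto_sum_real (ℱ := ℱ)
      (fun n => (T i).continuous.comp_stronglyMeasurable (hmeas n)) hi hi2 (fun n => ?_) ?_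
    · filter_upwards [(T i).comp_condExp_comm (m := ℱ n) (hint n), h0 n] with ω h1 h2
      have : (fun ω => T i (Z n ω)) = T i ∘ Z n := rfl
      rw [this, ← h1]; simp [h2]
    · refine Summable.of_nonneg_of_le (fun n => integral_nonneg fun ω => by positivity)
        (fun n => ?_) (hsum.mul_left (‖T i‖ ^ 2))
      rw [← integral_const_mul]
      exact integral_mono (hi2 n) ((hsq n).const_mul _) (hb n)
  filter_upwards [ae_all_iff.2 hcoord] with ω hω
  choose l hl using hω
  refine ⟨∑ i, l i • b i, ?_⟩
  have : Tendsto (fun n => ∑ i, (∑ j ∈ Finset.range n, T i (Z j ω)) • b i) atTop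
      (𝓝 (∑ i, l i • b i)) := tendsto_finsetSum _ fun i _ => (hl i).smul_const _
  refine this.congr fun n => ?_
  rw [← b.sum_repr (∑ j ∈ Finset.range n, Z j ω)]
  refine Finset.sum_congr rfl fun i _ => ?_
  congr 1
  rw [← b.coord_apply, map_sum]
  rfl

namespace IsMartingaleDifferenceNoise

variable [CompleteSpace V] {ℱ : Filtration ℕ mΩ} {M : ℕ → Ω → V} {R : ℕ → Ω → ℝ}

lemma condExp_indicator_eq_zero (hM : IsMartingaleDifferenceNoise μ ℱ M R) {n : ℕ} {A : Set Ω}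
    (hA : MeasurableSet[ℱ n] A) : μ[A.indicator (M n)|ℱ n] =ᵐ[μ] 0 := by
  filter_upwards [condExp_indicator (hM.integrable n) hA, hM.condExp_eq_zero n] with ω h1 h2
  rw [h1]
  by_cases hω : ω ∈ A <;> simp [hω, h2]

/-- On an event of ℱ n the square may be replaced by its conditional expectation. The majorant Q
carries the integrability, which is not assumed of R. -/
lemma setIntegral_sq_le [IsFiniteMeasure μ] (hM : IsMartingaleDifferenceNoise μ ℱ M R) {n : ℕ}
    {A : Set Ω} (hA : MeasurableSet[ℱ n] A) {C : ℝ}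
    (hC : ∀ᵐ ω ∂μ, (μ[fun ω => ‖M n ω‖ ^ 2|ℱ n]) ω ≤ C * (1 + R n ω)) {Q : Ω → ℝ}
    (hQ : IntegrableOn Q A μ) (hCQ : ∀ ω ∈ A, C * (1 + R n ω) ≤ Q ω) :
    ∫ ω in A, ‖M n ω‖ ^ 2 ∂μ ≤ ∫ ω in A, Q ω ∂μ := by
  rw [← setIntegral_condExp (ℱ.le n) (hM.integrable_sq n) hA]
  refine integral_mono_ae integrable_condExp.integrableOn hQ ?_
  rw [EventuallyLE, ae_restrict_iff' (ℱ.le n _ hA)]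
  filter_upwards [hC] with ω h1 h2 using h1.trans (hCQ ω h2)

/-- The weighted noise series converges along a sequence of events on which the conditional second
moments are bounded in mean. -/
lemma ae_exists_tendsto_sum_indicator [FiniteDimensional ℝ V] [IsProbabilityMeasure μ]
    (hM : IsMartingaleDifferenceNoise μ ℱ M R) {A : ℕ → Set Ω}
    (hA : ∀ n, MeasurableSet[ℱ n] (A n)) {a : ℕ → ℝ} (ha : Summable fun n => a n ^ 2) {U : ℝ}
    (hU : ∀ n, ∫ ω in A n, ‖M n ω‖ ^ 2 ∂μ ≤ U) :
    ∀ᵐ ω ∂μ, ∃ l, Tendsto (fun n => ∑ j ∈ Finset.range n, a j • (A j).indicator (M j) ω) atTop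
      (𝓝 l) := by
  have hsq : ∀ n ω, ‖a n • (A n).indicator (M n) ω‖ ^ 2 =
      a n ^ 2 * (A n).indicator (fun ω => ‖M n ω‖ ^ 2) ω := fun n ω => by
    rw [norm_smul, mul_pow, Real.norm_eq_abs, sq_abs]
    by_cases hω : ω ∈ A n <;> simp [hω]
  have hint : ∀ n, Integrable ((A n).indicator (M n)) μ := fun n =>
    (hM.integrable n).indicator (ℱ.le n _ (hA n))
  refine ae_exists_tendsto_sum (ℱ := ℱ)
    (fun n => ((hM.adapted n).indicator (ℱ.mono n.le_succ _ (hA n))).const_smul (a n))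
    (fun n => (hint n).smul (a n)) (fun n => ?_) (fun n => ?_) ?_
  · simp_rw [hsq]
    exact ((hM.integrable_sq n).indicator (ℱ.le n _ (hA n))).const_mul _
  · filter_upwards [condExp_smul (a n) ((A n).indicator (M n)) (ℱ n) (μ := μ),
      hM.condExp_indicator_eq_zero (hA n)] with ω h1 h2
    change (μ[a n • (A n).indicator (M n)|ℱ n]) ω = 0
    rw [h1]; simp [h2]
  · refine Summable.of_nonneg_of_le (fun n => integral_nonneg fun ω => by positivity)
      (fun n => ?_) (ha.mul_right U)
    simp_rw [hsq]
    rw [integral_const_mul, integral_indicator (ℱ.le n _ (hA n))]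
    exact mul_le_mul_of_nonneg_left (hU n) (sq_nonneg _)

end IsMartingaleDifferenceNoise

/-- Second moments of a stochastic recursion with a contracting drift stay bounded along a
decreasing sequence of events. -/
lemma exists_setIntegral_sq_le {F : Type*} [NormedAddCommGroup F] [InnerProductSpace ℝ F]
    [CompleteSpace F] [IsProbabilityMeasure μ] {ℱ : Filtration ℕ mΩ} {M : ℕ → Ω → F}
    {R : ℕ → Ω → ℝ} (hM : IsMartingaleDifferenceNoise μ ℱ M R) {A : ℕ → Set Ω}
    (hA : ∀ n, MeasurableSet[ℱ n] (A n)) {θ B : ℕ → Ω → F} (hθ : StronglyAdapted ℱ θ)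
    (hB : ∀ n, StronglyMeasurable[ℱ n] ((A n).indicator (B n))) {α : ℕ → ℝ} (hα : ∀ n, 0 < α n)
    (hstep : ∀ n ω, θ (n + 1) ω = B n ω + α n • M n ω) {n₀ : ℕ}
    (hanti : ∀ n, n₀ ≤ n → A (n + 1) ⊆ A n) {s c r ρ C : ℝ} (hs : 0 < s) (hc : 0 ≤ c)
    (hr : 0 ≤ r) (hC : 0 ≤ C)
    (hB2 : ∀ n, n₀ ≤ n → ∀ ω ∈ A n, ‖B n ω‖ ^ 2 ≤ (1 - s * α n) * ‖θ n ω‖ ^ 2 + α n * c)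
    (hR : ∀ n, n₀ ≤ n → ∀ ω ∈ A n, R n ω ≤ r + ‖θ n ω‖ ^ 2)
    (hMC : ∀ n, ∀ᵐ ω ∂μ, (μ[fun ω => ‖M n ω‖ ^ 2|ℱ n]) ω ≤ C * (1 + R n ω))
    (hα1 : ∀ n, n₀ ≤ n → α n ≤ 1) (hαs : ∀ n, n₀ ≤ n → s * α n ≤ 1)
    (hαC : ∀ n, n₀ ≤ n → α n * C ≤ s / 2) (hρ : ∀ ω ∈ A n₀, ‖θ n₀ ω‖ ^ 2 ≤ ρ) :
    ∃ U, ∀ n, n₀ ≤ n → IntegrableOn (fun ω => ‖θ n ω‖ ^ 2) (A n) μ ∧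
      ∫ ω in A n, ‖θ n ω‖ ^ 2 ∂μ ≤ U := by
  have hA' : ∀ n, MeasurableSet (A n) := fun n => ℱ.le n _ (hA n)
  have hθm : ∀ n (T : Set Ω), AEStronglyMeasurable (fun ω => ‖θ n ω‖ ^ 2) (μ.restrict T) :=
    fun n T => (((hθ n).mono (ℱ.le n)).norm.pow 2).aestronglyMeasurable
  set c' := c + C * (1 + r) with hc'
  have hc'0 : 0 ≤ c' := by positivity
  -- Chosen so that U bounds the initial moment and c' ≤ (s/2)U, which makes u ↦ (1 - sα/2)u + αc'
  -- preserve the bound u ≤ U.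
  set U := max (max ρ 0) (2 * c' / s) with hUdef
  have hU0 : 0 ≤ U := (le_max_right ρ 0).trans (le_max_left _ _)
  have hUs : c' ≤ s / 2 * U := by
    have : 2 * c' / s ≤ U := le_max_right _ _
    rw [div_le_iff₀ hs] at this; linarith
  have hreal : ∀ (n : ℕ) (T : Set Ω), μ.real T ≤ 1 := fun _ T => measureReal_le_one
  refine ⟨U, fun n hn => ?_⟩
  induction n, hn using Nat.le_induction with
  | base =>
    have hint : IntegrableOn (fun ω => ‖θ n₀ ω‖ ^ 2) (A n₀) μ := by
      refine (integrable_const ρ).mono' (hθm _ _) ?_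
      rw [ae_restrict_iff' (hA' _)]
      exact ae_of_all _ fun ω hω => by simpa using hρ ω hω
    refine ⟨hint, (setIntegral_mono_on hint (integrable_const (max ρ 0)).integrableOn (hA' _)
      fun ω hω => (hρ ω hω).trans (le_max_left _ _)).trans ?_⟩
    rw [setIntegral_const, smul_eq_mul]
    exact (mul_le_of_le_one_left (le_max_right _ _) (hreal n₀ _)).trans (le_max_left _ _)
  | succ n hn ih =>
    obtain ⟨ihI, ihU⟩ := ih
    have hαn := hα n
    -- Truncation to an event known at step n preserves the orthogonality of drift and noise, and
    -- agrees with the recursion on the smaller event of step n + 1.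
    set B' := (A n).indicator (B n) with hB'
    set M' := α n • (A n).indicator (M n) with hM'
    have hBsq : ∀ ω, ‖B' ω‖ ^ 2 = (A n).indicator (fun ω => ‖B n ω‖ ^ 2) ω := fun ω => by
      by_cases hω : ω ∈ A n <;> simp [hB', hω]
    have hMsq : ∀ ω, ‖M' ω‖ ^ 2 = α n ^ 2 * (A n).indicator (fun ω => ‖M n ω‖ ^ 2) ω := fun ω => by
      simp only [hM', Pi.smul_apply]
      rw [norm_smul, mul_pow, Real.norm_eq_abs, sq_abs]
      by_cases hω : ω ∈ A n <;> simp [hω]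
    have hQ : IntegrableOn (fun ω => (1 - s * α n) * ‖θ n ω‖ ^ 2 + α n * c) (A n) μ :=
      (ihI.const_mul _).add (integrable_const _)
    have hBint : Integrable (fun ω => ‖B' ω‖ ^ 2) μ := by
      refine (hQ.integrable_indicator (hA' n)).mono'
        (((hB n).mono (ℱ.le n)).norm.pow 2).aestronglyMeasurable (ae_of_all _ fun ω => ?_)
      rw [norm_pow, norm_norm, hBsq]
      exact indicator_le_indicator' fun hω => hB2 n hn ω hω
    have hM0 : μ[M'|ℱ n] =ᵐ[μ] 0 := by
      filter_upwards [condExp_smul (α n) ((A n).indicator (M n)) (ℱ n) (μ := μ),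
        hM.condExp_indicator_eq_zero (hA n)] with ω h1 h2
      rw [h1]; simp [h2]
    have hMint : Integrable (fun ω => ‖M' ω‖ ^ 2) μ := by
      simp_rw [hMsq]
      exact ((hM.integrable_sq n).indicator (hA' n)).const_mul _
    obtain ⟨hI, hE⟩ := integral_norm_add_sq_eq (ℱ.le n) (hB n) hBint
      (((hM.integrable n).indicator (hA' n)).smul (α n)) hMint hM0
    have hθeq : ∀ ω ∈ A (n + 1), ‖θ (n + 1) ω‖ ^ 2 = ‖B' ω + M' ω‖ ^ 2 := fun ω hω => by
      have := hanti n hn hω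
      simp [hstep, hB', hM', this]
    have hint : IntegrableOn (fun ω => ‖θ (n + 1) ω‖ ^ 2) (A (n + 1)) μ :=
      (integrableOn_congr_fun hθeq (hA' _)).2 hI.integrableOn
    refine ⟨hint, ?_⟩
    have h1 : ∫ ω in A (n + 1), ‖θ (n + 1) ω‖ ^ 2 ∂μ ≤ ∫ ω, ‖B' ω + M' ω‖ ^ 2 ∂μ := by
      rw [setIntegral_congr_fun (hA' _) hθeq]
      exact setIntegral_le_integral hI (ae_of_all _ fun ω => by positivity)
    have h2 : ∫ ω, ‖B' ω‖ ^ 2 ∂μ ≤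
        (1 - s * α n) * ∫ ω in A n, ‖θ n ω‖ ^ 2 ∂μ + α n * c := by
      simp_rw [hBsq]
      rw [integral_indicator (hA' n)]
      refine (setIntegral_mono_on ?_ hQ (hA' n) (hB2 n hn)).trans ?_
      · exact (integrable_indicator_iff (hA' n)).1 (hBint.congr (ae_of_all _ hBsq))
      · rw [integral_add (ihI.const_mul _) (integrable_const _), integral_const_mul,
          setIntegral_const, smul_eq_mul]
        exact add_le_add_right (mul_le_of_le_one_left (by positivity) (hreal n _)) _
    have h3 : ∫ ω, ‖M' ω‖ ^ 2 ∂μ ≤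
        α n ^ 2 * (C * (1 + r) + C * ∫ ω in A n, ‖θ n ω‖ ^ 2 ∂μ) := by
      simp_rw [hMsq]
      rw [integral_const_mul, integral_indicator (hA' n)]
      gcongr
      have hCi : IntegrableOn (fun ω => C * ‖θ n ω‖ ^ 2) (A n) μ := ihI.const_mul _
      have hQi : IntegrableOn (fun ω => C * (1 + r) + C * ‖θ n ω‖ ^ 2) (A n) μ :=
        (integrable_const _).add hCi
      refine (hM.setIntegral_sq_le (hA n) (hMC n) hQi fun ω hω => ?_).trans ?_
      · have := hR n hn ω hω
        nlinarith
      · rw [integral_add (integrable_const _) hCi, setIntegral_const, integral_const_mul,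
          smul_eq_mul]
        exact add_le_add_left (mul_le_of_le_one_left (by positivity) (hreal n _)) _
    have hu0 : 0 ≤ ∫ ω in A n, ‖θ n ω‖ ^ 2 ∂μ := integral_nonneg fun ω => by positivity
    set u := ∫ ω in A n, ‖θ n ω‖ ^ 2 ∂μ
    -- The part of the noise variance that grows with θ uses up at most half of the contraction.
    have h4 : α n ^ 2 * (C * u) ≤ α n * (s / 2) * u := by
      have := mul_le_mul_of_nonneg_left (hαC n hn) (mul_nonneg hαn.le hu0)
      nlinarith
    have h5 : α n ^ 2 * (C * (1 + r)) ≤ α n * (C * (1 + r)) := by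
      refine mul_le_mul_of_nonneg_right ?_ (by positivity)
      nlinarith [hα1 n hn]
    calc _ ≤ _ := h1
      _ ≤ (1 - s * α n) * u + α n * c + α n ^ 2 * (C * (1 + r) + C * u) := by
        rw [hE]; exact add_le_add h2 h3
      _ ≤ (1 - s / 2 * α n) * u + α n * c' := by rw [hc']; nlinarith
      _ ≤ (1 - s / 2 * α n) * U + α n * (s / 2 * U) := by
        gcongr
        nlinarith [hαs n hn]
      _ = U := by ring

end Noise

/-! ### Two-timescale stochastic approximation with an affine fast recursion -/

/-- An open subset of a finite-dimensional space is exhausted by countably many compact sets. -/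
lemma IsOpen.exists_compact_cover {E : Type*} [TopologicalSpace E] [LocallyCompactSpace E]
    [SecondCountableTopology E] {D : Set E} (hD : IsOpen D) :
    ∃ K : ℕ → Set E, (∀ n, IsCompact (K n) ∧ K n ⊆ D) ∧
      ∀ C, IsCompact C → C ⊆ D → ∃ n, C ⊆ K n := by
  have := hD.locallyCompactSpace
  let K := CompactExhaustion.choice D
  refine ⟨fun n => Subtype.val '' K n, fun n => ⟨(K.isCompact n).image continuous_subtype_val,
    by rintro _ ⟨x, -, rfl⟩; exact x.2⟩, fun C hC hCD => ?_⟩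
  obtain ⟨n, hn⟩ := K.exists_superset_of_isCompact (s := Subtype.val ⁻¹' C)
    (Topology.IsInducing.subtypeVal.isCompact_preimage' hC (by simpa using hCD))
  exact ⟨n, fun x hx => ⟨⟨x, hCD hx⟩, hn hx, rfl⟩⟩

/-- Finitely many terms only shift the limit. This returns from the truncated noise to the true
noise on a path lying in all the events from n₀ on. -/
lemma exists_tendsto_sum_of_eventually_eq {V : Type*} [NormedAddCommGroup V] {f g : ℕ → V} {N : ℕ}
    (h : ∀ n, N ≤ n → f n = g n)
    (hf : ∃ l, Tendsto (fun n => ∑ j ∈ Finset.range n, f j) atTop (𝓝 l)) :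
    ∃ l, Tendsto (fun n => ∑ j ∈ Finset.range n, g j) atTop (𝓝 l) := by
  obtain ⟨l, hl⟩ := hf
  refine ⟨l + ∑ j ∈ Finset.range N, (g j - f j), ?_⟩
  refine (hl.add_const _).congr' ?_
  filter_upwards [eventually_ge_atTop N] with n hn
  have : ∑ j ∈ Finset.range N, (g j - f j) = ∑ j ∈ Finset.range n, (g j - f j) := by
    refine Finset.sum_subset (Finset.range_mono hn) fun j _ hj => ?_
    rw [h j (by simpa using hj), sub_self]
  rw [this, ← Finset.sum_add_distrib]
  simp

section TwoTimescale

variable {E F : Type*} [NormedAddCommGroup E] [NormedSpace ℝ E] [FiniteDimensional ℝ E]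
  [CompleteSpace E] [MeasurableSpace E] [BorelSpace E]
  [NormedAddCommGroup F] [InnerProductSpace ℝ F] [FiniteDimensional ℝ F] [CompleteSpace F]
  [MeasurableSpace F] [BorelSpace F] {D : Set E} {h : E → F → F} {G : E → F →L[ℝ] F}
  {Ω : Type*} {mΩ : MeasurableSpace Ω} {μ : Measure Ω} [IsProbabilityMeasure μ]
  {ℱ : Filtration ℕ mΩ} {α β : ℕ → ℝ}

omit [FiniteDimensional ℝ E] [NormedSpace ℝ E] [CompleteSpace E] [MeasurableSpace E] [BorelSpace E]
  [CompleteSpace F] [MeasurableSpace F] [BorelSpace F] in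
/-- The drift of one small step of a dissipative affine recursion contracts, uniformly over
compact sets of parameters. -/
lemma IsAffineDissipativeOn.exists_norm_add_smul_sq_le (H : IsAffineDissipativeOn D h G)
    {K : Set E} (hK : IsCompact K) (hKD : K ⊆ D) :
    ∃ s > 0, ∃ c, 0 ≤ c ∧ ∃ ε > 0, ∀ a, 0 ≤ a → a ≤ ε → ∀ x ∈ K, ∀ θ : F,
      ‖θ + a • h x θ‖ ^ 2 ≤ (1 - s * a) * ‖θ‖ ^ 2 + a * c := by
  obtain ⟨κ, hκ, hG⟩ := H.exists_pos_le_inner hK hKD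
  obtain ⟨g, hg0, hg⟩ := H.exists_norm_apply_le hK hKD
  obtain ⟨b, hb⟩ := hK.exists_bound_of_continuousOn (f := fun x => h x 0)
    (H.lipschitz.continuousOn.comp (f := fun x : E => (x, (0 : F))) (by fun_prop)
      fun x hx => ⟨hKD hx, trivial⟩)
  refine ⟨κ / 2, half_pos hκ, b ^ 2 / (κ / 2), by positivity,
    min (κ / (g ^ 2 + 1)) (2 / κ), by positivity, fun a ha hle x hx θ => ?_⟩
  have h1 : a * (g ^ 2 + 1) ≤ κ := by
    rw [← le_div_iff₀ (by positivity)]; exact hle.trans (min_le_left _ _)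
  have h2 : a * κ ≤ 2 := by rw [← le_div_iff₀ hκ]; exact hle.trans (min_le_right _ _)
  have hb0 : 0 ≤ b := (norm_nonneg _).trans (hb x hx)
  have h3 : ‖θ + a • h x θ‖ ≤ (1 - κ / 2 * a) * ‖θ‖ + a * b := by
    have : θ + a • h x θ = (θ - a • G x θ) + a • h x 0 := by
      rw [H.affine x θ, smul_sub]; abel
    rw [this]
    refine (norm_add_le _ _).trans (add_le_add
      (norm_sub_smul_le (hG x hx) (hg x hx) ha (by nlinarith) h2 θ) ?_)
    rw [norm_smul, Real.norm_of_nonneg ha]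
    exact mul_le_mul_of_nonneg_left (hb x hx) ha
  have h4 := pow_le_pow_left₀ (norm_nonneg _) h3 2
  refine h4.trans ?_
  set s := κ / 2 with hs
  have hs0 : 0 < s := half_pos hκ
  -- Convexity of the square with its exact defect: a convex combination of ‖θ‖ and b/s with weight
  -- s a on the latter.
  have h5 : ((1 - s * a) * ‖θ‖ + a * b) ^ 2 =
      (1 - s * a) * ‖θ‖ ^ 2 + a * (b ^ 2 / s) - (1 - s * a) * (s * a) * (‖θ‖ - b / s) ^ 2 := by
    field_simp; ring
  rw [h5, sub_le_self_iff]
  have : 0 ≤ 1 - s * a := by rw [hs]; linarith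
  positivity

/-- Almost surely, the noise series of both recursions converge if the slow iterates eventually
stay in a compact subset of `D`. -/
theorem IsAffineDissipativeOn.ae_exists_tendsto_noise (H : IsAffineDissipativeOn D h G)
    (hD : IsOpen D) (hsteps : IsTwoTimescaleSteps α β) {ξ : ℕ → Ω → E} {θ : ℕ → Ω → F}
    {M : ℕ → Ω → F} {N : ℕ → Ω → E} (hξ : StronglyAdapted ℱ ξ) (hθ : StronglyAdapted ℱ θ)
    (hM : IsMartingaleDifferenceNoise μ ℱ M fun t ω => ‖ξ t ω‖ ^ 2 + ‖θ t ω‖ ^ 2)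
    (hN : IsMartingaleDifferenceNoise μ ℱ N fun t ω => ‖ξ t ω‖ ^ 2 + ‖θ t ω‖ ^ 2)
    (hstep : ∀ t ω, θ (t + 1) ω = θ t ω + α t • (h (ξ t ω) (θ t ω) + M t ω)) :
    ∀ᵐ ω ∂μ, ∀ C ⊆ D, IsCompact C → (∀ᶠ t in atTop, ξ t ω ∈ C) →
      (∃ l, Tendsto (fun n => ∑ j ∈ Finset.range n, α j • M j ω) atTop (𝓝 l)) ∧
      ∃ l, Tendsto (fun n => ∑ j ∈ Finset.range n, β j • N j ω) atTop (𝓝 l) := by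
  have : ProperSpace E := FiniteDimensional.proper_real E
  have : ProperSpace F := FiniteDimensional.proper_real F
  obtain ⟨K, hK, hKC⟩ := hD.exists_compact_cover
  have hα2 : Summable fun t => α t ^ 2 := hsteps.sum_sq.of_nonneg_of_le
    (fun t => sq_nonneg _) fun t => le_add_of_nonneg_right (sq_nonneg _)
  have hβ2 : Summable fun t => β t ^ 2 := hsteps.sum_sq.of_nonneg_of_le
    (fun t => sq_nonneg _) fun t => le_add_of_nonneg_left (sq_nonneg _)
  have hα0 : Tendsto α atTop (𝓝 0) := by
    have := (hα2.tendsto_atTop_zero).sqrt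
    simpa [Real.sqrt_sq (hsteps.pos_fast _).le] using this
  obtain ⟨C₁, hC₁⟩ := hM.condExp_sq_le
  obtain ⟨C₂, hC₂⟩ := hN.condExp_sq_le
  have hR0 : ∀ t ω, 0 ≤ 1 + (‖ξ t ω‖ ^ 2 + ‖θ t ω‖ ^ 2) := fun t ω => by positivity
  replace hC₁ : ∀ t, ∀ᵐ ω ∂μ, (μ[fun ω => ‖M t ω‖ ^ 2|ℱ t]) ω ≤
      |C₁| * (1 + (‖ξ t ω‖ ^ 2 + ‖θ t ω‖ ^ 2)) := fun t => (hC₁ t).mono fun ω hω =>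
    hω.trans (mul_le_mul_of_nonneg_right (le_abs_self _) (hR0 t ω))
  replace hC₂ : ∀ t, ∀ᵐ ω ∂μ, (μ[fun ω => ‖N t ω‖ ^ 2|ℱ t]) ω ≤
      |C₂| * (1 + (‖ξ t ω‖ ^ 2 + ‖θ t ω‖ ^ 2)) := fun t => (hC₂ t).mono fun ω hω =>
    hω.trans (mul_le_mul_of_nonneg_right (le_abs_self _) (hR0 t ω))
  have hloc : ∀ k : ℕ, ∃ n₁ : ℕ, ∀ n₀, n₁ ≤ n₀ → ∀ ρ : ℕ, ∀ᵐ ω ∂μ, ‖θ n₀ ω‖ ≤ ρ →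
      (∀ t, n₀ ≤ t → ξ t ω ∈ K k) →
      (∃ l, Tendsto (fun n => ∑ j ∈ Finset.range n, α j • M j ω) atTop (𝓝 l)) ∧
      ∃ l, Tendsto (fun n => ∑ j ∈ Finset.range n, β j • N j ω) atTop (𝓝 l) := by
    intro k
    obtain ⟨hKc, hKD⟩ := hK k
    obtain ⟨s, hs, c, hc, ε, hε, hdrift⟩ := H.exists_norm_add_smul_sq_le hKc hKD
    obtain ⟨r, hr⟩ := hKc.exists_bound_of_continuousOn continuousOn_id
    have hev : ∀ d, 0 < d → ∀ᶠ t in atTop, α t ≤ d := fun d hd =>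
      (hα0.eventually_lt_const hd).mono fun _ h => h.le
    obtain ⟨n₁, hn₁⟩ := eventually_atTop.1 ((((hev ε hε).and (hev 1 one_pos)).and
      (hev (1 / s) (by positivity))).and (hev (s / 2 / (|C₁| + 1)) (by positivity)))
    refine ⟨n₁, fun n₀ hn₀ ρ => ?_⟩
    -- Requiring n₀ ≤ t makes the earlier events empty: θ n₀ is not known to be measurable before
    -- step n₀, and no moment bound is available there.
    set A : ℕ → Set Ω := fun t =>
      {ω | n₀ ≤ t ∧ ‖θ n₀ ω‖ ≤ ρ ∧ ∀ j, n₀ ≤ j → j ≤ t → ξ j ω ∈ K k} with hAdef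
    have hA : ∀ t, MeasurableSet[ℱ t] (A t) := fun t => by
      by_cases ht : n₀ ≤ t
      · have : A t = (fun ω => ‖θ n₀ ω‖) ⁻¹' Iic (ρ : ℝ) ∩
            ⋂ j, ⋂ (_ : n₀ ≤ j), ⋂ (_ : j ≤ t), ξ j ⁻¹' K k := by
          ext ω; simp [hAdef, ht]
        rw [this]
        refine MeasurableSet.inter
          (((hθ n₀).mono (ℱ.mono ht)).norm.measurable measurableSet_Iic)
          (MeasurableSet.iInter fun j => MeasurableSet.iInter fun _ =>
            MeasurableSet.iInter fun hj =>
              ((hξ j).mono (ℱ.mono hj)).measurable hKc.isClosed.measurableSet)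
      · have : A t = ∅ := by ext ω; simp [hAdef, ht]
        rw [this]; exact @MeasurableSet.empty _ (ℱ t)
    have hAK : ∀ t, ∀ ω ∈ A t, ξ t ω ∈ K k := fun t ω hω => hω.2.2 t hω.1 le_rfl
    have hR : ∀ t, n₀ ≤ t → ∀ ω ∈ A t, ‖ξ t ω‖ ^ 2 + ‖θ t ω‖ ^ 2 ≤ r ^ 2 + ‖θ t ω‖ ^ 2 :=
      fun t _ ω hω => by
        have := pow_le_pow_left₀ (norm_nonneg _) (hr _ (hAK t ω hω)) 2
        simpa using this
    -- Outside D nothing is known about h, not even measurability, so it is cut off to the closed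
    -- set where it is continuous.
    have hhm : Measurable ((K k ×ˢ (univ : Set F)).indicator fun p : E × F => h p.1 p.2) := by
      classical
      rw [← piecewise_eq_indicator]
      exact ContinuousOn.measurable_piecewise
        (H.lipschitz.continuousOn.mono (prod_mono hKD le_rfl)) continuousOn_const
        (hKc.isClosed.prod isClosed_univ).measurableSet
    have hB : ∀ t, StronglyMeasurable[ℱ t]
        ((A t).indicator fun ω => θ t ω + α t • h (ξ t ω) (θ t ω)) := fun t => by
      have h1 : StronglyMeasurable[ℱ t] fun ω => (K k ×ˢ (univ : Set F)).indicator
          (fun p : E × F => h p.1 p.2) (ξ t ω, θ t ω) :=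
        (hhm.comp ((hξ t).prodMk (hθ t)).measurable).stronglyMeasurable
      have h2 := ((hθ t).add (h1.const_smul (α t))).indicator (hA t)
      convert h2 using 1
      ext ω
      by_cases hω : ω ∈ A t
      · simp [hω, hAK t ω hω]
      · simp [hω]
    obtain ⟨U, hU⟩ := exists_setIntegral_sq_le (n₀ := n₀) (s := s) (c := c) (r := r ^ 2)
      (ρ := (ρ : ℝ) ^ 2) (C := |C₁|) hM hA hθ hB hsteps.pos_fast
      (fun t ω => by rw [hstep, smul_add, add_assoc])
      (fun t ht ω hω => ⟨ht, hω.2.1, fun j h1 h2 => hω.2.2 j h1 (h2.trans t.le_succ)⟩)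
      hs hc (sq_nonneg _) (abs_nonneg _)
      (fun t ht ω hω => hdrift _ (hsteps.pos_fast t).le (hn₁ t (hn₀.trans ht)).1.1.1 _
        (hAK t ω hω) _)
      hR hC₁ (fun t ht => (hn₁ t (hn₀.trans ht)).1.1.2)
      (fun t ht => by
        have := (hn₁ t (hn₀.trans ht)).1.2
        rwa [le_div_iff₀ hs, mul_comm] at this)
      (fun t ht => by
        have h1 := (hn₁ t (hn₀.trans ht)).2
        rw [le_div_iff₀ (by positivity)] at h1
        have := hsteps.pos_fast t
        nlinarith)
      (fun ω hω => pow_le_pow_left₀ (norm_nonneg _) hω.2.1 2)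
    -- Here g stands for the squared norm of either noise; one computation serves both time scales.
    have hbound : ∀ C, 0 ≤ C → ∃ U', ∀ t, ∀ g : Ω → ℝ, (n₀ ≤ t →
        ∀ Q : Ω → ℝ, IntegrableOn Q (A t) μ →
          (∀ ω ∈ A t, C * (1 + (‖ξ t ω‖ ^ 2 + ‖θ t ω‖ ^ 2)) ≤ Q ω) →
          ∫ ω in A t, g ω ∂μ ≤ ∫ ω in A t, Q ω ∂μ) → ∫ ω in A t, g ω ∂μ ≤ U' := by
      intro C hC
      refine ⟨C * (1 + r ^ 2) + C * |U|, fun t g hg => ?_⟩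
      by_cases ht : n₀ ≤ t
      · obtain ⟨hI, hUt⟩ := hU t ht
        have hCi : IntegrableOn (fun ω => C * ‖θ t ω‖ ^ 2) (A t) μ := hI.const_mul _
        have hQi : IntegrableOn (fun ω => C * (1 + r ^ 2) + C * ‖θ t ω‖ ^ 2) (A t) μ :=
          (integrable_const _).add hCi
        refine (hg ht _ hQi fun ω hω => ?_).trans ?_
        · have := mul_le_mul_of_nonneg_left (hR t ht ω hω) hC
          linarith
        · rw [integral_add (integrable_const _) hCi, setIntegral_const, integral_const_mul,
            smul_eq_mul]
          exact add_le_add (mul_le_of_le_one_left (by positivity) measureReal_le_one)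
            (mul_le_mul_of_nonneg_left (hUt.trans (le_abs_self _)) hC)
      · have : A t = ∅ := by ext ω; simp [hAdef, ht]
        rw [this]; simp; positivity
    obtain ⟨U₁, hU₁⟩ := hbound |C₁| (abs_nonneg _)
    obtain ⟨U₂, hU₂⟩ := hbound |C₂| (abs_nonneg _)
    have hS₁ := hM.ae_exists_tendsto_sum_indicator hA hα2 (U := U₁) fun t =>
      hU₁ t _ fun _ Q hQ hCQ => hM.setIntegral_sq_le (hA t) (hC₁ t) hQ hCQ
    have hS₂ := hN.ae_exists_tendsto_sum_indicator hA hβ2 (U := U₂) fun t =>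
      hU₂ t _ fun _ Q hQ hCQ => hN.setIntegral_sq_le (hA t) (hC₂ t) hQ hCQ
    filter_upwards [hS₁, hS₂] with ω h1 h2 hρ hξK
    have hmem : ∀ t, n₀ ≤ t → ω ∈ A t := fun t ht => ⟨ht, hρ, fun j hj _ => hξK j hj⟩
    exact ⟨exists_tendsto_sum_of_eventually_eq (N := n₀) (fun t ht => by simp [hmem t ht]) h1,
      exists_tendsto_sum_of_eventually_eq (N := n₀) (fun t ht => by simp [hmem t ht]) h2⟩
  choose n₁ hn₁ using hloc
  -- Compact set, starting step and initial bound range over countable families, so one null set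
  -- suffices for all of them.
  have hall : ∀ᵐ ω ∂μ, ∀ k n₀ : ℕ, n₁ k ≤ n₀ → ∀ ρ : ℕ, ‖θ n₀ ω‖ ≤ ρ →
      (∀ t, n₀ ≤ t → ξ t ω ∈ K k) →
      (∃ l, Tendsto (fun n => ∑ j ∈ Finset.range n, α j • M j ω) atTop (𝓝 l)) ∧
      ∃ l, Tendsto (fun n => ∑ j ∈ Finset.range n, β j • N j ω) atTop (𝓝 l) := by
    simp only [ae_all_iff]
    exact hn₁
  filter_upwards [hall] with ω hω C hCD hC hξC
  obtain ⟨k, hk⟩ := hKC C hC hCD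
  obtain ⟨m, hm⟩ := eventually_atTop.1 hξC
  obtain ⟨ρ, hρ⟩ := exists_nat_ge ‖θ (max m (n₁ k)) ω‖
  exact hω k _ (le_max_right _ _) ρ hρ fun t ht => hk (hm t ((le_max_left _ _).trans ht))

omit [FiniteDimensional ℝ E] [CompleteSpace E] [MeasurableSpace E] [BorelSpace E] in
/-- Removing a convergent noise series from a recursion. -/
lemma exists_recursion_without_noise {a : ℕ → ℝ} {x v M : ℕ → E}
    (hx : ∀ n, x (n + 1) = x n + a n • (v n + M n))
    (hM : ∃ l, Tendsto (fun n => ∑ j ∈ Finset.range n, a j • M j) atTop (𝓝 l)) :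
    ∃ y : ℕ → E, (∀ n, y (n + 1) = y n + a n • v n) ∧
      Tendsto (fun n => x n - y n) atTop (𝓝 0) := by
  obtain ⟨l, hl⟩ := hM
  refine ⟨fun n => x n + (l - ∑ j ∈ Finset.range n, a j • M j), fun n => ?_, ?_⟩
  · simp only [hx, Finset.sum_range_succ, smul_add]; abel
  · simpa using hl.sub_const l

omit [CompleteSpace E] [MeasurableSpace E] [BorelSpace E] [CompleteSpace F] [MeasurableSpace F]
  [BorelSpace F] in
/-- Convergence of two-timescale recursions along a realization for which the noise series
converge. -/
theorem IsAffineDissipativeOn.tendsto_of_tendsto_noise (H : IsAffineDissipativeOn D h G)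
    (hD : IsOpen D) {Λ : E → F} (hΛ : ∀ x ∈ D, h x (Λ x) = 0) {f : E → F → E}
    (hf : LocallyLipschitzOn (D ×ˢ (univ : Set F)) fun p => f p.1 p.2)
    {b : ℝ} (hfb : ∀ x ∈ D, ∀ θ, ‖f x θ‖ ≤ b + ‖x‖) (hsteps : IsTwoTimescaleSteps α β) {z : E}
    (hz : IsAsymptoticallyStable (fun x => f x (Λ x)) D z) {ξ N : ℕ → E} {θ M : ℕ → F}
    (hξ : ∀ t, ξ (t + 1) = ξ t + β t • (f (ξ t) (θ t) + N t))
    (hθ : ∀ t, θ (t + 1) = θ t + α t • (h (ξ t) (θ t) + M t))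
    (hM : ∃ l, Tendsto (fun n => ∑ j ∈ Finset.range n, α j • M j) atTop (𝓝 l))
    (hN : ∃ l, Tendsto (fun n => ∑ j ∈ Finset.range n, β j • N j) atTop (𝓝 l))
    {C : Set E} (hC : IsCompact C) (hCB : C ⊆ basinOfAttraction (fun x => f x (Λ x)) D z)
    (hξC : ∀ᶠ t in atTop, ξ t ∈ C) :
    Tendsto ξ atTop (𝓝 z) ∧ Tendsto θ atTop (𝓝 (Λ z)) := by
  have : ProperSpace F := FiniteDimensional.proper_real F
  have hCD : C ⊆ D := fun u hu => by
    obtain ⟨⟨γ, hγ, rfl⟩, -⟩ := hCB hu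
    exact hγ.2 0 le_rfl
  have hzero : ∀ a : ℕ → ℝ, (∀ t, 0 < a t) → (∀ t, a t ^ 2 ≤ α t ^ 2 + β t ^ 2) →
      Tendsto a atTop (𝓝 0) := fun a ha hle => by
    have h1 : Summable fun t => a t ^ 2 :=
      hsteps.sum_sq.of_nonneg_of_le (fun t => sq_nonneg _) hle
    simpa [Real.sqrt_sq (ha _).le] using h1.tendsto_atTop_zero.sqrt
  have hα0 := hzero α hsteps.pos_fast fun t => le_add_of_nonneg_right (sq_nonneg _)
  have hβ0 := hzero β hsteps.pos_slow fun t => le_add_of_nonneg_left (sq_nonneg _)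
  obtain ⟨ζ, hζ, hξζ⟩ := exists_recursion_without_noise hξ hN
  obtain ⟨y, hy, hθy⟩ := exists_recursion_without_noise hθ hM
  obtain ⟨r, hr⟩ := hC.exists_bound_of_continuousOn continuousOn_id
  have hfast : Tendsto (fun n => θ n - Λ (ξ n)) atTop (𝓝 0) :=
    H.tendsto_sub_equilibrium hD hΛ hsteps.pos_fast hsteps.pos_slow hα0 hsteps.sum_fast
      hsteps.ratio hC hCD hξC hζ (B := b + r)
      (hξC.mono fun n hn => (hfb _ (hCD hn) _).trans (add_le_add_right (hr _ hn) b)) hξζ hy hθy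
  have hΛlip := H.locallyLipschitzOn_equilibrium hD hΛ
  obtain ⟨L, hL⟩ := (hΛlip.mono hCD).exists_lipschitzOnWith_of_compact hC
  have hslow : LocallyLipschitzOn D fun x => f x (Λ x) := fun x hx => by
    obtain ⟨L₁, t₁, ht₁, hL₁⟩ := hΛlip hx
    obtain ⟨L₂, t₂, ht₂, hL₂⟩ := hf (x := (x, Λ x)) ⟨hx, trivial⟩
    have hg : Tendsto (fun x => (x, Λ x)) (𝓝[D] x) (𝓝[D ×ˢ univ] (x, Λ x)) :=
      tendsto_nhdsWithin_iff.2 ⟨(tendsto_id.mono_left nhdsWithin_le_nhds).prodMk_nhds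
        (hΛlip.continuousOn x hx), eventually_mem_nhdsWithin.mono fun u hu => ⟨hu, trivial⟩⟩
    refine ⟨L₂ * max 1 L₁, t₁ ∩ (fun x => (x, Λ x)) ⁻¹' t₂, inter_mem ht₁ (hg ht₂), ?_⟩
    exact hL₂.comp (g := fun p : E × F => f p.1 p.2)
      ((LipschitzWith.id.lipschitzOnWith.prodMk hL₁).mono inter_subset_left)
      fun u hu => hu.2
  have hcomp : IsCompact (Λ '' C) := hC.image_of_continuousOn hL.continuousOn
  -- Tracking puts θ eventually within distance 1 of Λ(C), so f has a single Lipschitz constant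
  -- along the run.
  have hKc : IsCompact (C ×ˢ Metric.cthickening 1 (Λ '' C)) := hC.prod hcomp.cthickening
  obtain ⟨Lf, hLf⟩ := (hf.mono (prod_mono hCD (subset_univ _))).exists_lipschitzOnWith_of_compact
    hKc
  have hw : Tendsto (fun n => f (ξ n) (θ n) - f (ξ n) (Λ (ξ n))) atTop (𝓝 0) := by
    rw [tendsto_zero_iff_norm_tendsto_zero]
    have h0 : Tendsto (fun n => (Lf : ℝ) * ‖θ n - Λ (ξ n)‖) atTop (𝓝 0) := by
      simpa using hfast.norm.const_mul (Lf : ℝ)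
    refine squeeze_zero' (Eventually.of_forall fun _ => norm_nonneg _) ?_ h0
    have h1 : ∀ᶠ n in atTop, ‖θ n - Λ (ξ n)‖ < 1 := by
      have := hfast.norm
      rw [norm_zero] at this
      exact this.eventually_lt_const one_pos
    filter_upwards [hξC, h1] with n hn hn1
    have hmem : Λ (ξ n) ∈ Λ '' C := ⟨_, hn, rfl⟩
    have := hLf.dist_le_mul (ξ n, θ n)
      ⟨hn, Metric.mem_cthickening_of_dist_le _ _ _ _ hmem (by rw [dist_eq_norm]; exact hn1.le)⟩
      (ξ n, Λ (ξ n)) ⟨hn, Metric.self_subset_cthickening _ hmem⟩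
    rwa [dist_eq_norm, Prod.dist_eq, dist_self, max_eq_right dist_nonneg, dist_eq_norm] at this
  have hlim : Tendsto ξ atTop (𝓝 z) := tendsto_of_perturbed_of_basin hslow hz hC hCB
    hsteps.pos_slow hβ0 hsteps.sum_slow hζ hw hξζ hξC
  refine ⟨hlim, ?_⟩
  have hΛlim : Tendsto (fun n => Λ (ξ n)) atTop (𝓝 (Λ z)) :=
    (hΛlip.continuousOn.continuousAt (hD.mem_nhds hz.mem)).tendsto.comp hlim
  simpa using hfast.add hΛlim

end TwoTimescale

/-! ### Bregman divergences -/

section Bregman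

variable {V : Type*} [NormedAddCommGroup V] [NormedSpace ℝ V] {ρ : V → ℝ}

namespace IsBregmanGenerator

lemma continuous_fderiv (h : IsBregmanGenerator ρ) : Continuous (fderiv ℝ ρ) :=
  h.differentiable_fderiv.continuous

lemma continuous_left (h : IsBregmanGenerator ρ) (μ : V) : Continuous fun x => bregmanDiv ρ x μ := by
  have := h.differentiable.continuous
  unfold bregmanDiv
  fun_prop

lemma continuous_right (h : IsBregmanGenerator ρ) (x : V) :
    Continuous fun μ => bregmanDiv ρ x μ := by
  have := h.differentiable.continuous
  have := h.continuous_fderiv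
  unfold bregmanDiv
  fun_prop

/-- On the line from μ to x, the slope of a convex function over [0, 1] is at least its derivative
at 0. -/
lemma nonneg (h : IsBregmanGenerator ρ) (x μ : V) : 0 ≤ bregmanDiv ρ x μ := by
  have hconv : ConvexOn ℝ univ (ρ ∘ (AffineMap.lineMap μ x : ℝ →ᵃ[ℝ] V)) := by
    simpa using h.strictConvex.convexOn.comp_affineMap (AffineMap.lineMap μ x : ℝ →ᵃ[ℝ] V)
  have hder : HasDerivAt (ρ ∘ (AffineMap.lineMap μ x : ℝ →ᵃ[ℝ] V)) (fderiv ℝ ρ μ (x - μ)) 0 := by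
    have h1 : HasFDerivAt ρ (fderiv ℝ ρ μ) ((AffineMap.lineMap μ x : ℝ →ᵃ[ℝ] V) 0) := by
      simpa using (h.differentiable μ).hasFDerivAt
    exact h1.comp_hasDerivAt 0 AffineMap.hasDerivAt_lineMap
  have := hconv.le_slope_of_hasDerivAt (mem_univ 0) (mem_univ 1) one_pos hder
  simp only [slope_def_field, Function.comp_apply, AffineMap.lineMap_apply_one,
    AffineMap.lineMap_apply_zero, sub_zero, div_one] at this
  unfold bregmanDiv
  linarith

/-- With equal derivatives at μ ≠ ν, averaging the two tangent inequalities at the midpoint cancels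
the linear terms and contradicts strict convexity. -/
lemma fderiv_injective (h : IsBregmanGenerator ρ) : Function.Injective (fderiv ℝ ρ) := by
  intro μ ν hμν
  by_contra hne
  have h1 := h.strictConvex.2 (mem_univ μ) (mem_univ ν) hne
    (by norm_num : (0 : ℝ) < 1 / 2) (by norm_num : (0 : ℝ) < 1 / 2) (by norm_num)
  set x := (1 / 2 : ℝ) • μ + (1 / 2 : ℝ) • ν with hx
  have h2 := h.nonneg x μ
  have h3 := h.nonneg x ν
  simp only [bregmanDiv, hμν, map_sub] at h2 h3
  have h4 : fderiv ℝ ρ ν x = 1 / 2 * fderiv ℝ ρ ν μ + 1 / 2 * fderiv ℝ ρ ν ν := by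
    rw [hx, map_add, map_smul, map_smul, smul_eq_mul, smul_eq_mul]
  rw [h4] at h2 h3
  simp only [smul_eq_mul] at h1
  linarith

/-- Points equidistant from two distinct points form a null set. -/
lemma ae_bregmanDiv_ne [MeasurableSpace V] [BorelSpace V] [FiniteDimensional ℝ V]
    (h : IsBregmanGenerator ρ) (vol : Measure V) [vol.IsAddHaarMeasure] {μ ν : V} (hne : μ ≠ ν) :
    ∀ᵐ x ∂vol, bregmanDiv ρ x μ ≠ bregmanDiv ρ x ν := by
  set T := fderiv ℝ ρ μ - fderiv ℝ ρ ν with hT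
  have hT0 : T ≠ 0 := sub_ne_zero.2 fun h' => hne (h.fderiv_injective h')
  -- The term ρ x cancels, so the difference of divergences is affine in x with linear part -T ≠ 0;
  -- its zero set is empty or a translate of ker T.
  have hdiff : ∀ x y, bregmanDiv ρ x μ - bregmanDiv ρ x ν -
      (bregmanDiv ρ y μ - bregmanDiv ρ y ν) = -T (x - y) := fun x y => by
    simp only [bregmanDiv, hT, sub_apply, map_sub]; ring
  rw [ae_iff]
  by_cases hex : ∃ p, bregmanDiv ρ p μ = bregmanDiv ρ p ν
  · obtain ⟨p, hp⟩ := hex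
    have hset : {x | ¬bregmanDiv ρ x μ ≠ bregmanDiv ρ x ν} =
        (fun x => x + -p) ⁻¹' (LinearMap.ker (T : V →ₗ[ℝ] ℝ) : Set V) := by
      ext x
      have := hdiff x p
      rw [hp, sub_self, sub_zero] at this
      simp only [mem_ofPred_eq, not_not, mem_preimage, SetLike.mem_coe, LinearMap.mem_ker,
        ContinuousLinearMap.coe_coe, ← sub_eq_add_neg]
      rw [← sub_eq_zero, this, neg_eq_zero]
    rw [hset, measure_preimage_add_right]
    refine Measure.addHaar_submodule _ _ fun htop => hT0 ?_
    ext x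
    exact LinearMap.mem_ker.1 (htop ▸ Submodule.mem_top : x ∈ LinearMap.ker (T : V →ₗ[ℝ] ℝ))
  · push Not at hex
    simp [hex]

end IsBregmanGenerator

end Bregman

/-! ### The local models -/

section LocalModel

open scoped RealInnerProductSpace

variable {d m : ℕ}

lemma localModel_add (φ : EuclideanSpace ℝ (Fin d)) (u v : EuclideanSpace ℝ (Fin d × Fin m)) :
    localModel φ (u + v) = localModel φ u + localModel φ v := by
  ext k; simp [localModel, mul_add, Finset.sum_add_distrib]

lemma localModel_smul (φ : EuclideanSpace ℝ (Fin d)) (c : ℝ)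
    (u : EuclideanSpace ℝ (Fin d × Fin m)) : localModel φ (c • u) = c • localModel φ u := by
  ext k; simp [localModel, Finset.mul_sum, mul_left_comm]

lemma inner_localModelTranspose (φ : EuclideanSpace ℝ (Fin d)) (e : EuclideanSpace ℝ (Fin m))
    (u : EuclideanSpace ℝ (Fin d × Fin m)) :
    ⟪localModelTranspose φ e, u⟫ = ⟪e, localModel φ u⟫ := by
  simp only [PiLp.inner_apply, localModelTranspose, localModel, Fintype.sum_prod_type,
    RCLike.inner_apply, conj_trivial, Finset.sum_mul]
  rw [Finset.sum_comm]
  exact Finset.sum_congr rfl fun k _ => Finset.sum_congr rfl fun a _ => by ring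

lemma norm_localModelTranspose (φ : EuclideanSpace ℝ (Fin d)) (e : EuclideanSpace ℝ (Fin m)) :
    ‖localModelTranspose φ e‖ = ‖φ‖ * ‖e‖ := by
  rw [← sq_eq_sq₀ (norm_nonneg _) (by positivity), mul_pow]
  simp only [EuclideanSpace.norm_sq_eq, localModelTranspose, Fintype.sum_prod_type,
    Finset.sum_mul_sum, norm_mul, mul_pow]

lemma norm_localModel_le (φ : EuclideanSpace ℝ (Fin d)) (u : EuclideanSpace ℝ (Fin d × Fin m)) :
    ‖localModel φ u‖ ≤ ‖φ‖ * ‖u‖ := by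
  rcases (norm_nonneg (localModel φ u)).eq_or_lt with h | h
  · rw [← h]; positivity
  · refine le_of_mul_le_mul_left ?_ h
    calc _ = ⟪localModel φ u, localModel φ u⟫ := (real_inner_self_eq_norm_mul_norm _).symm
      _ = ⟪localModelTranspose φ (localModel φ u), u⟫ := (inner_localModelTranspose _ _ _).symm
      _ ≤ ‖localModelTranspose φ (localModel φ u)‖ * ‖u‖ := real_inner_le_norm _ _
      _ = _ := by rw [norm_localModelTranspose]; ring

lemma continuous_localModel (u : EuclideanSpace ℝ (Fin d × Fin m)) :
    Continuous fun φ : EuclideanSpace ℝ (Fin d) => localModel φ u := by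
  unfold localModel; fun_prop

lemma continuous_localModelTranspose :
    Continuous fun p : EuclideanSpace ℝ (Fin d) × EuclideanSpace ℝ (Fin m) =>
      localModelTranspose p.1 p.2 := by
  unfold localModelTranspose; fun_prop

end LocalModel

/-- A linear self-map of a finite-dimensional space is continuous. -/
noncomputable def IsLinearMap.toContinuousLinearMap {F : Type*} [NormedAddCommGroup F]
    [NormedSpace ℝ F] [FiniteDimensional ℝ F] {f : F → F} (hf : IsLinearMap ℝ f) : F →L[ℝ] F :=
  LinearMap.toContinuousLinearMap hf.mk'

namespace IdentModel

open scoped RealInnerProductSpace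

variable {m d K s : ℕ} (A : IdentModel m d K s)

/-! ### The Voronoi cells -/

lemma measurableSet_cell (ξ : CodeState K d) (i : Fin K) : MeasurableSet (A.cell ξ i) := by
  have hc := fun j => (A.genS_bregman.continuous_left (codevector ξ j)).measurable
  have : A.cell ξ i = A.S ∩ ((⋂ j, {φ | bregmanDiv A.genS φ (codevector ξ i) ≤
      bregmanDiv A.genS φ (codevector ξ j)}) ∩ ⋂ j, ⋂ (_ : j < i),
        {φ | bregmanDiv A.genS φ (codevector ξ i) < bregmanDiv A.genS φ (codevector ξ j)}) := by
    ext φ; simp [cell]; tauto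
  rw [this]
  exact A.measurableSet_S.inter ((MeasurableSet.iInter fun j => measurableSet_le (hc i) (hc j)).inter
    (MeasurableSet.iInter fun j => MeasurableSet.iInter fun _ => measurableSet_lt (hc i) (hc j)))

lemma eq_of_mem_cell {ξ : CodeState K d} {i j : Fin K} {φ : EuclideanSpace ℝ (Fin d)}
    (hi : φ ∈ A.cell ξ i) (hj : φ ∈ A.cell ξ j) : i = j := by
  rcases lt_trichotomy i j with h | h | h
  · exact absurd (hj.2.2 i h) (not_lt.2 (hi.2.1 j))
  · exact h
  · exact absurd (hi.2.2 j h) (not_lt.2 (hj.2.1 i))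

lemma measurableSet_region (ξ : CodeState K d) (i : Fin s) : MeasurableSet (A.region ξ i) :=
  MeasurableSet.iUnion fun j => MeasurableSet.iUnion fun _ => A.measurableSet_cell ξ j

lemma eq_of_mem_region {ξ : CodeState K d} {i j : Fin s} {φ : EuclideanSpace ℝ (Fin d)}
    (hi : φ ∈ A.region ξ i) (hj : φ ∈ A.region ξ j) : i = j := by
  simp only [region, mem_iUnion] at hi hj
  obtain ⟨a, rfl, ha⟩ := hi
  obtain ⟨b, rfl, hb⟩ := hj
  rw [A.eq_of_mem_cell ha hb]

/-- With a unique nearest codevector, no tie-breaking is needed. -/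
lemma mem_cell_iff {ξ : CodeState K d} {φ : EuclideanSpace ℝ (Fin d)} {i₀ : Fin K} (hφ : φ ∈ A.S)
    (h : ∀ j, j ≠ i₀ → bregmanDiv A.genS φ (codevector ξ i₀) <
      bregmanDiv A.genS φ (codevector ξ j)) (i : Fin K) : φ ∈ A.cell ξ i ↔ i = i₀ := by
  have h₀ : φ ∈ A.cell ξ i₀ := ⟨hφ, fun j => by
    rcases eq_or_ne j i₀ with rfl | hj
    · exact le_rfl
    · exact (h j hj).le, fun j hj => h j hj.ne⟩
  exact ⟨fun hi => A.eq_of_mem_cell hi h₀, fun hi => hi ▸ h₀⟩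

/-- A unique nearest codevector is expressed by finitely many strict inequalities, continuous in the
codevectors, so it persists. For distinct limits, ties fill only finitely many null sets. -/
lemma partitionTendsto {ξ : ℕ → CodeState K d} {ξ' : CodeState K d}
    (h : ∀ i, Tendsto (fun t => codevector (ξ t) i) atTop (𝓝 (codevector ξ' i))) :
    PartitionTendsto A ξ ξ' := by
  have hmain : ∀ φ ∈ A.S, (∃ i, ∀ j, j ≠ i →
      bregmanDiv A.genS φ (codevector ξ' i) < bregmanDiv A.genS φ (codevector ξ' j)) →
      ∀ i, ∀ᶠ t in atTop, (φ ∈ A.cell (ξ t) i ↔ φ ∈ A.cell ξ' i) := by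
    rintro φ hφ ⟨i₀, hi₀⟩ i
    have hlim := fun j => ((A.genS_bregman.continuous_right φ).tendsto _).comp (h j)
    have hev : ∀ᶠ t in atTop, ∀ j, j ≠ i₀ → bregmanDiv A.genS φ (codevector (ξ t) i₀) <
        bregmanDiv A.genS φ (codevector (ξ t) j) := by
      refine eventually_all.2 fun j => ?_
      by_cases hj : j = i₀
      · exact Eventually.of_forall fun t h' => absurd hj h'
      · exact ((hlim i₀).eventually_lt (hlim j) (hi₀ j hj)).mono fun t ht _ => ht
    filter_upwards [hev] with t ht
    rw [A.mem_cell_iff hφ ht, A.mem_cell_iff hφ hi₀]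
  refine ⟨hmain, fun hinj i => ?_⟩
  have hne : ∀ᵐ φ : EuclideanSpace ℝ (Fin d), ∀ j k, j ≠ k →
      bregmanDiv A.genS φ (codevector ξ' j) ≠ bregmanDiv A.genS φ (codevector ξ' k) := by
    refine ae_all_iff.2 fun j => ae_all_iff.2 fun k => ?_
    by_cases hjk : j = k
    · exact ae_of_all _ fun φ h' => absurd hjk h'
    · exact (A.genS_bregman.ae_bregmanDiv_ne volume (hinj.ne hjk)).mono fun φ h _ => h
  filter_upwards [hne] with φ hφ
  by_cases hS : φ ∈ A.S
  · have : Nonempty (Fin K) := ⟨i⟩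
    obtain ⟨i₀, hi₀⟩ := Finite.exists_min fun j => bregmanDiv A.genS φ (codevector ξ' j)
    exact hmain φ hS ⟨i₀, fun j hj => lt_of_le_of_ne (hi₀ j) (hφ i₀ j hj.symm)⟩ i
  · exact Eventually.of_forall fun t => iff_of_false (fun h' => hS h'.1) fun h' => hS h'.1

lemma tendsto_codevector {ξ : ℕ → CodeState K d} {ξ' : CodeState K d} (h : Tendsto ξ atTop (𝓝 ξ'))
    {i : Fin K} (hi : (ξ' i).1 ≠ 0) :
    Tendsto (fun t => codevector (ξ t) i) atTop (𝓝 (codevector ξ' i)) := by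
  have := tendsto_pi_nhds.1 h i
  exact (this.fst_nhds.inv₀ hi).smul this.snd_nhds

/-! ### The mean field of the slow recursion -/

lemma assocProb_mem_Icc {ξ : CodeState K d} (hξ : ∀ i, 0 < (ξ i).1) (θ : ParamState s d m)
    (x : Observation m d) (i : Fin K) : A.assocProb ξ θ x i ∈ Icc (0 : ℝ) 1 := by
  have hpos : ∀ j, 0 ≤ A.gibbsWeight ξ θ x j := fun j => mul_nonneg (hξ j).le (Real.exp_nonneg _)
  have hsum : A.gibbsWeight ξ θ x i ≤ ∑ j, A.gibbsWeight ξ θ x j :=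
    Finset.single_le_sum (fun j _ => hpos j) (Finset.mem_univ i)
  exact ⟨div_nonneg (hpos i) ((hpos i).trans hsum), div_le_one_of_le₀ hsum ((hpos i).trans hsum)⟩

lemma integrable_norm_regressor : Integrable (fun x : Observation m d => ‖x.2‖) A.law := by
  have := A.isProbabilityMeasure_law
  refine ((integrable_const (1 : ℝ)).add A.integrable_sq_regressor).mono'
    (by fun_prop) (ae_of_all _ fun x => ?_)
  simp only [norm_norm, Pi.add_apply]
  nlinarith [sq_nonneg (‖x.2‖ - 1), norm_nonneg x.2]

/-- Association probabilities lie in [0, 1], so the bound is uniform in θ. It controls the slow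
speed before anything is known about the fast iterates. -/
lemma norm_hSlow_le {ξ : CodeState K d} (hξ : ∀ i, 0 < (ξ i).1) (θ : ParamState s d m) :
    ‖A.hSlow ξ θ‖ ≤ (1 + ∫ x, ‖x.2‖ ∂A.law) + ‖ξ‖ := by
  have := A.isProbabilityMeasure_law
  have hE : 0 ≤ ∫ x, ‖x.2‖ ∂A.law := integral_nonneg fun x => norm_nonneg _
  refine (pi_norm_le_iff_of_nonneg (by positivity)).2 fun i => ?_
  have hp := fun x => A.assocProb_mem_Icc hξ θ x i
  have hn := norm_le_pi_norm ξ i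
  have h1 : ‖∫ x, A.assocProb ξ θ x i ∂A.law‖ ≤ 1 := by
    refine (norm_integral_le_of_norm_le (integrable_const (μ := A.law) (1 : ℝ))
      (ae_of_all _ fun x => ?_)).trans_eq (by simp)
    rw [Real.norm_of_nonneg (hp x).1]; exact (hp x).2
  have h2 : ‖∫ x, A.assocProb ξ θ x i • x.2 ∂A.law‖ ≤ ∫ x, ‖x.2‖ ∂A.law :=
    norm_integral_le_of_norm_le A.integrable_norm_regressor (ae_of_all _ fun x => by
      rw [norm_smul, Real.norm_of_nonneg (hp x).1]
      exact mul_le_of_le_one_left (norm_nonneg _) (hp x).2)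
  rw [Prod.norm_def]
  refine max_le ?_ ?_
  · refine (norm_sub_le _ _).trans ?_
    linarith [(norm_fst_le (ξ i)).trans hn]
  · refine (norm_sub_le _ _).trans ?_
    linarith [(norm_snd_le (ξ i)).trans hn]

/-! ### The mean field of the fast recursion -/

/-- The switched linear regression `∑_i 1[φ ∈ S_i] [φᵀ ⊗ I_m] θ_i`. -/
noncomputable def predictor (ξ : CodeState K d) (θ : ParamState s d m)
    (φ : EuclideanSpace ℝ (Fin d)) : EuclideanSpace ℝ (Fin m) :=
  ∑ i, (A.region ξ i).indicator (fun φ => localModel φ (θ i)) φ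

lemma error_eq (ξ : CodeState K d) (θ : ParamState s d m) (x : Observation m d) :
    A.error ξ θ x = A.predictor ξ θ x.2 - x.1 := rfl

lemma predictor_add (ξ : CodeState K d) (θ η : ParamState s d m) (φ : EuclideanSpace ℝ (Fin d)) :
    A.predictor ξ (θ + η) φ = A.predictor ξ θ φ + A.predictor ξ η φ := by
  simp only [predictor, ← Finset.sum_add_distrib]
  refine Finset.sum_congr rfl fun i _ => ?_
  by_cases h : φ ∈ A.region ξ i <;> simp [h, localModel_add]

lemma predictor_smul (ξ : CodeState K d) (c : ℝ) (θ : ParamState s d m)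
    (φ : EuclideanSpace ℝ (Fin d)) : A.predictor ξ (c • θ) φ = c • A.predictor ξ θ φ := by
  simp only [predictor, Finset.smul_sum]
  refine Finset.sum_congr rfl fun i _ => ?_
  by_cases h : φ ∈ A.region ξ i <;> simp [h, localModel_smul]

lemma predictor_zero (ξ : CodeState K d) (φ : EuclideanSpace ℝ (Fin d)) :
    A.predictor ξ 0 φ = 0 := by
  simpa using A.predictor_smul ξ 0 0 φ

lemma predictor_of_mem {ξ : CodeState K d} {i : Fin s} {φ : EuclideanSpace ℝ (Fin d)}
    (h : φ ∈ A.region ξ i) (θ : ParamState s d m) :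
    A.predictor ξ θ φ = localModel φ (θ i) := by
  rw [predictor, Finset.sum_eq_single i, indicator_of_mem h]
  · intro j _ hj
    exact indicator_of_notMem (fun h' => hj (A.eq_of_mem_region h' h)) _
  · simp

lemma norm_predictor_le (ξ : CodeState K d) (θ : ParamState s d m)
    (φ : EuclideanSpace ℝ (Fin d)) : ‖A.predictor ξ θ φ‖ ≤ ‖φ‖ * ‖θ‖ := by
  by_cases h : ∃ i, φ ∈ A.region ξ i
  · obtain ⟨i, hi⟩ := h
    rw [A.predictor_of_mem hi]
    exact (norm_localModel_le _ _).trans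
      (mul_le_mul_of_nonneg_left (PiLp.norm_apply_le _ _) (norm_nonneg _))
  · push Not at h
    have : A.predictor ξ θ φ = 0 := Finset.sum_eq_zero fun i _ => indicator_of_notMem (h i) _
    rw [this, norm_zero]; positivity

lemma measurable_predictor (ξ : CodeState K d) (θ : ParamState s d m) :
    Measurable (A.predictor ξ θ) :=
  Finset.measurable_fun_sum _ fun i _ =>
    (continuous_localModel (θ i)).measurable.indicator (A.measurableSet_region ξ i)

lemma measurable_error (ξ : CodeState K d) (θ : ParamState s d m) :
    Measurable (A.error ξ θ) :=
  ((A.measurable_predictor ξ θ).comp measurable_snd).sub measurable_fst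

/-- The update is minus the adjoint of the predictor applied to the error; this reduces the mean
field to scalar integrals. -/
lemma inner_fastUpdate (ξ : CodeState K d) (θ η : ParamState s d m) (x : Observation m d) :
    ⟪A.fastUpdate ξ θ x, η⟫ = -⟪A.error ξ θ x, A.predictor ξ η x.2⟫ := by
  rw [PiLp.inner_apply, predictor, inner_sum, ← Finset.sum_neg_distrib]
  refine Finset.sum_congr rfl fun i _ => ?_
  by_cases h : x.2 ∈ A.region ξ i <;> simp [fastUpdate, h, inner_localModelTranspose]

lemma norm_fastUpdate_le (ξ : CodeState K d) (θ : ParamState s d m) (x : Observation m d) :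
    ‖A.fastUpdate ξ θ x‖ ≤ ‖A.error ξ θ x‖ * ‖x.2‖ := by
  rcases (norm_nonneg (A.fastUpdate ξ θ x)).eq_or_lt with h | h
  · rw [← h]; positivity
  · refine le_of_mul_le_mul_left ?_ h
    calc _ = ⟪A.fastUpdate ξ θ x, A.fastUpdate ξ θ x⟫ :=
          (real_inner_self_eq_norm_mul_norm _).symm
      _ ≤ ‖A.error ξ θ x‖ * ‖A.predictor ξ (A.fastUpdate ξ θ x) x.2‖ := by
          rw [inner_fastUpdate, ← inner_neg_left]
          exact (real_inner_le_norm _ _).trans_eq (by rw [norm_neg])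
      _ ≤ ‖A.error ξ θ x‖ * (‖x.2‖ * ‖A.fastUpdate ξ θ x‖) := by
          gcongr; exact A.norm_predictor_le _ _ _
      _ = _ := by ring

lemma measurable_fastUpdate (ξ : CodeState K d) (θ : ParamState s d m) :
    Measurable (A.fastUpdate ξ θ) := by
  refine (PiLp.continuous_toLp 2 _).measurable.comp (measurable_pi_iff.2 fun i => ?_)
  have h1 : Measurable fun x : Observation m d => localModelTranspose x.2 (A.error ξ θ x) :=
    continuous_localModelTranspose.measurable.comp (measurable_snd.prodMk (A.measurable_error ξ θ))
  exact (h1.indicator (measurable_snd (A.measurableSet_region ξ i))).neg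

lemma integrable_error_sq (ξ : CodeState K d) (θ : ParamState s d m) :
    Integrable (fun x => ‖A.error ξ θ x‖ ^ 2) A.law := by
  refine ((A.integrable_sq_regressor.const_mul (2 * ‖θ‖ ^ 2)).add
    (A.integrable_sq_output.const_mul 2)).mono'
    ((A.measurable_error ξ θ).norm.pow_const 2).aestronglyMeasurable (ae_of_all _ fun x => ?_)
  have h1 : ‖A.error ξ θ x‖ ≤ ‖x.2‖ * ‖θ‖ + ‖x.1‖ :=
    (norm_sub_le _ _).trans (add_le_add_left (A.norm_predictor_le _ _ _) _)
  have h2 := pow_le_pow_left₀ (norm_nonneg _) h1 2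
  simp only [norm_pow, norm_norm, Pi.add_apply]
  nlinarith [sq_nonneg (‖x.2‖ * ‖θ‖ - ‖x.1‖)]

lemma integrable_predictor_sq (ξ : CodeState K d) (θ : ParamState s d m) :
    Integrable (fun x : Observation m d => ‖A.predictor ξ θ x.2‖ ^ 2) A.law := by
  refine (A.integrable_sq_regressor.const_mul (‖θ‖ ^ 2)).mono'
    (((A.measurable_predictor ξ θ).comp measurable_snd).norm.pow_const 2).aestronglyMeasurable
    (ae_of_all _ fun x => ?_)
  have h2 := pow_le_pow_left₀ (norm_nonneg _) (A.norm_predictor_le ξ θ x.2) 2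
  simp only [norm_pow, norm_norm]
  nlinarith

lemma integrable_inner_predictor (ξ : CodeState K d) (θ η : ParamState s d m) :
    Integrable (fun x : Observation m d => ⟪A.predictor ξ θ x.2, A.predictor ξ η x.2⟫) A.law :=
  integrable_inner_of_sq ((A.measurable_predictor ξ θ).comp measurable_snd).aestronglyMeasurable
    ((A.measurable_predictor ξ η).comp measurable_snd).aestronglyMeasurable
    (A.integrable_predictor_sq ξ θ) (A.integrable_predictor_sq ξ η)

lemma integrable_inner_error (ξ : CodeState K d) (θ η : ParamState s d m) :
    Integrable (fun x : Observation m d => ⟪A.error ξ θ x, A.predictor ξ η x.2⟫) A.law :=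
  integrable_inner_of_sq (A.measurable_error ξ θ).aestronglyMeasurable
    ((A.measurable_predictor ξ η).comp measurable_snd).aestronglyMeasurable
    (A.integrable_error_sq ξ θ) (A.integrable_predictor_sq ξ η)

lemma integrable_fastUpdate (ξ : CodeState K d) (θ : ParamState s d m) :
    Integrable (A.fastUpdate ξ θ) A.law := by
  refine ((A.integrable_error_sq ξ θ).add A.integrable_sq_regressor).mono'
    (A.measurable_fastUpdate ξ θ).aestronglyMeasurable (ae_of_all _ fun x => ?_)
  refine (A.norm_fastUpdate_le ξ θ x).trans ?_
  simp only [Pi.add_apply]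
  nlinarith [sq_nonneg (‖A.error ξ θ x‖ - ‖x.2‖), norm_nonneg (A.error ξ θ x), norm_nonneg x.2]

lemma inner_integral_fastUpdate (ξ : CodeState K d) (θ η : ParamState s d m) :
    ⟪∫ x, A.fastUpdate ξ θ x ∂A.law, η⟫ =
      -∫ x, ⟪A.error ξ θ x, A.predictor ξ η x.2⟫ ∂A.law := by
  rw [real_inner_comm, ← integral_inner (A.integrable_fastUpdate ξ θ), ← integral_neg]
  refine integral_congr_ae (ae_of_all _ fun x => ?_)
  simp only
  rw [real_inner_comm, inner_fastUpdate]

/-- The loss is quadratic. -/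
lemma loss_add (ξ : CodeState K d) (θ η : ParamState s d m) :
    A.loss ξ (θ + η) = A.loss ξ θ - ⟪∫ x, A.fastUpdate ξ θ x ∂A.law, η⟫ +
      2⁻¹ * ∫ x, ‖A.predictor ξ η x.2‖ ^ 2 ∂A.law := by
  have h1 : ∀ x, ‖A.error ξ (θ + η) x‖ ^ 2 = ‖A.error ξ θ x‖ ^ 2 +
      2 * ⟪A.error ξ θ x, A.predictor ξ η x.2⟫ + ‖A.predictor ξ η x.2‖ ^ 2 := fun x => by
    rw [← norm_add_sq_real, error_eq, error_eq, predictor_add]; congr 2; abel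
  have h2 : Integrable (fun x : Observation m d =>
      2 * ⟪A.error ξ θ x, A.predictor ξ η x.2⟫) A.law :=
    (A.integrable_inner_error ξ θ η).const_mul 2
  have h3 : Integrable (fun x => ‖A.error ξ θ x‖ ^ 2 +
      2 * ⟪A.error ξ θ x, A.predictor ξ η x.2⟫) A.law := (A.integrable_error_sq ξ θ).add h2
  rw [inner_integral_fastUpdate, loss, loss]
  simp_rw [h1]
  rw [integral_add h3 (A.integrable_predictor_sq ξ η), integral_add (A.integrable_error_sq ξ θ) h2,
    integral_const_mul]
  ring

/-- The mean field of the fast recursion is the expected update direction. -/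
lemma hFast_eq (ξ : CodeState K d) (θ : ParamState s d m) :
    A.hFast ξ θ = ∫ x, A.fastUpdate ξ θ x ∂A.law := by
  have hg : HasGradientAt (A.loss ξ) (-∫ x, A.fastUpdate ξ θ x ∂A.law) θ := by
    rw [hasGradientAt_iff_isLittleO_nhds_zero]
    -- No differentiation under the integral is needed: the remainder is exactly half the second
    -- moment of the predictor of η, hence quadratic in ‖η‖.
    have h1 : (fun η : ParamState s d m => A.loss ξ (θ + η) - A.loss ξ θ -
        ⟪-∫ x, A.fastUpdate ξ θ x ∂A.law, η⟫) =O[𝓝 0] fun η => ‖η‖ ^ 2 := by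
      refine Asymptotics.IsBigO.of_bound (∫ x, ‖x.2‖ ^ 2 ∂A.law) (Eventually.of_forall fun η => ?_)
      have h0 : 0 ≤ ∫ x, ‖A.predictor ξ η x.2‖ ^ 2 ∂A.law := integral_nonneg fun x => by positivity
      rw [loss_add, inner_neg_left, norm_pow, norm_norm]
      have h2 : ∫ x, ‖A.predictor ξ η x.2‖ ^ 2 ∂A.law ≤ (∫ x, ‖x.2‖ ^ 2 ∂A.law) * ‖η‖ ^ 2 := by
        rw [← integral_mul_const]
        refine integral_mono (A.integrable_predictor_sq ξ η) (A.integrable_sq_regressor.mul_const _)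
          fun x => ?_
        simp only [← mul_pow]
        exact pow_le_pow_left₀ (norm_nonneg _) (A.norm_predictor_le _ _ _) 2
      rw [show ∀ a b c : ℝ, a - b + c - a - -b = c by intros; ring, Real.norm_of_nonneg (by positivity)]
      linarith
    refine h1.trans_isLittleO ?_
    simpa using (Asymptotics.isLittleO_norm_pow_id (E' := ParamState s d m) one_lt_two)
  rw [hFast, hg.gradient, neg_neg]

/-- The output ψ cancels, leaving the Gram form of the predictor. Linearity and positivity of the
information operator are both read off from it. -/
lemma inner_hFast_sub (ξ : CodeState K d) (θ η : ParamState s d m) :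
    ⟪A.hFast ξ 0 - A.hFast ξ θ, η⟫ =
      ∫ x, ⟪A.predictor ξ θ x.2, A.predictor ξ η x.2⟫ ∂A.law := by
  rw [inner_sub_left, hFast_eq, hFast_eq, inner_integral_fastUpdate, inner_integral_fastUpdate,
    neg_sub_neg, ← integral_sub (A.integrable_inner_error _ _ _) (A.integrable_inner_error _ _ _)]
  refine integral_congr_ae (ae_of_all _ fun x => ?_)
  simp [error_eq, predictor_zero, inner_sub_left]

lemma hFast_sub_add (ξ : CodeState K d) (θ η : ParamState s d m) :
    A.hFast ξ 0 - A.hFast ξ (θ + η) =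
      (A.hFast ξ 0 - A.hFast ξ θ) + (A.hFast ξ 0 - A.hFast ξ η) := by
  refine ext_inner_right ℝ fun v => ?_
  simp only [inner_add_left, inner_hFast_sub, predictor_add]
  exact integral_add (A.integrable_inner_predictor _ _ _) (A.integrable_inner_predictor _ _ _)

lemma hFast_sub_smul (ξ : CodeState K d) (c : ℝ) (θ : ParamState s d m) :
    A.hFast ξ 0 - A.hFast ξ (c • θ) = c • (A.hFast ξ 0 - A.hFast ξ θ) := by
  refine ext_inner_right ℝ fun v => ?_
  simp only [real_inner_smul_left, inner_hFast_sub, predictor_smul, integral_const_mul]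

/-- The information operator: minus the linear part of `θ ↦ h_θ(ξ, θ)`. -/
noncomputable def infoOperator (ξ : CodeState K d) : ParamState s d m →L[ℝ] ParamState s d m :=
  IsLinearMap.toContinuousLinearMap (f := fun θ => A.hFast ξ 0 - A.hFast ξ θ)
    ⟨A.hFast_sub_add ξ, A.hFast_sub_smul ξ⟩

lemma infoOperator_apply (ξ : CodeState K d) (θ : ParamState s d m) :
    A.infoOperator ξ θ = A.hFast ξ 0 - A.hFast ξ θ := rfl

/-- The quadratic form of the matrix of persistent excitation. -/
lemma dotProduct_excitation (ξ : CodeState K d) (i : Fin s) (v : Fin d → ℝ) :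
    v ⬝ᵥ (Matrix.of fun a b : Fin d =>
      ∫ x, (A.region ξ i).indicator (fun φ => φ a * φ b) x.2 ∂A.law).mulVec v =
    ∫ x, (A.region ξ i).indicator (fun φ => (∑ a, φ a * v a) ^ 2) x.2 ∂A.law := by
  have hint : ∀ a b, Integrable (fun x : Observation m d =>
      (A.region ξ i).indicator (fun φ => φ a * φ b) x.2) A.law := fun a b => by
    refine A.integrable_sq_regressor.mono' (Measurable.aestronglyMeasurable
      ((Measurable.indicator (by fun_prop) (A.measurableSet_region ξ i)).comp measurable_snd))
      (ae_of_all _ fun x => ?_)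
    refine (norm_indicator_le_norm_self _ _).trans ?_
    rw [norm_mul, sq]
    exact mul_le_mul (PiLp.norm_apply_le _ _) (PiLp.norm_apply_le _ _) (norm_nonneg _)
      (norm_nonneg _)
  have hexp : ∀ x : Observation m d,
      (A.region ξ i).indicator (fun φ => (∑ a, φ a * v a) ^ 2) x.2 =
      ∑ a, ∑ b, v a * v b * (A.region ξ i).indicator (fun φ => φ a * φ b) x.2 := fun x => by
    by_cases h : x.2 ∈ A.region ξ i
    · simp only [indicator_of_mem h, sq, Finset.sum_mul_sum]
      exact Finset.sum_congr rfl fun a _ => Finset.sum_congr rfl fun b _ => by ring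
    · simp [h]
  simp_rw [hexp]
  rw [integral_finsetSum _ fun a _ => integrable_finsetSum _ fun b _ => (hint a b).const_mul _]
  simp only [dotProduct, Matrix.mulVec, Matrix.of_apply, Finset.mul_sum]
  refine Finset.sum_congr rfl fun a _ => ?_
  rw [integral_finsetSum _ fun b _ => (hint a b).const_mul _]
  refine Finset.sum_congr rfl fun b _ => ?_
  rw [integral_const_mul]
  ring

/-- If the form vanishes at u, the predictor of u is almost surely 0. A nonzero row of some block
Θ_i would then be orthogonal to almost every regressor in region i, against positive definiteness of
its excitation matrix. -/
lemma inner_infoOperator_pos {ξ : CodeState K d} (hPE : ∀ i, A.PersistentlyExciting ξ i)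
    {u : ParamState s d m} (hu : u ≠ 0) : 0 < ⟪u, A.infoOperator ξ u⟫ := by
  rw [real_inner_comm, infoOperator_apply, inner_hFast_sub]
  simp_rw [real_inner_self_eq_norm_sq]
  refine lt_of_le_of_ne (integral_nonneg fun x => by positivity) fun h0 => hu ?_
  have hae := (integral_eq_zero_iff_of_nonneg (fun x => by positivity)
    (A.integrable_predictor_sq ξ u)).1 h0.symm
  ext i p
  obtain ⟨a, k⟩ := p
  by_contra hne
  have hv : (fun a => u i (a, k)) ≠ 0 := fun h => hne (by simpa using congrFun h a)
  have hpos := (hPE i).dotProduct_mulVec_pos hv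
  rw [star_trivial, dotProduct_excitation] at hpos
  refine hpos.ne' (integral_eq_zero_of_ae ?_)
  filter_upwards [hae] with x hx
  by_cases h : x.2 ∈ A.region ξ i
  · have h1 : A.predictor ξ u x.2 = 0 := by simpa using hx
    rw [A.predictor_of_mem h] at h1
    have h2 := congrArg (fun y : EuclideanSpace ℝ (Fin m) => y k) h1
    simp only [localModel, PiLp.zero_apply] at h2
    simp [h, h2]
  · simp [h]

lemma isAffineDissipativeOn {D : Set (CodeState K d)}
    (hPE : ∀ ξ ∈ D, ∀ i, A.PersistentlyExciting ξ i)
    (hLip : LocallyLipschitzOn (D ×ˢ (univ : Set (ParamState s d m)))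
      fun p => A.hFast p.1 p.2) : IsAffineDissipativeOn D A.hFast A.infoOperator where
  affine ξ θ := by rw [infoOperator_apply, sub_sub_cancel]
  pos ξ hξ _ hu := A.inner_infoOperator_pos (hPE ξ hξ) hu
  lipschitz := hLip

end IdentModel

theorem mainTheorem5 {m d K s : ℕ} (A : IdentModel m d K s)
    (D : Set (CodeState K d)) (hD : IsOpen D)
    (hpos : ∀ ξ ∈ D, ∀ i, 0 < (ξ i).1)
    (hPE : ∀ ξ ∈ D, ∀ i, A.PersistentlyExciting ξ i)
    (hLipFast : LocallyLipschitzOn (D ×ˢ (univ : Set (ParamState s d m)))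
      (fun p => A.hFast p.1 p.2))
    (hLipSlow : LocallyLipschitzOn (D ×ˢ (univ : Set (ParamState s d m)))
      (fun p => A.hSlow p.1 p.2))
    {Ω : Type*} [MeasurableSpace Ω] (μ : Measure Ω) [IsProbabilityMeasure μ] :
    ∃ Λ : CodeState K d → ParamState s d m,
      LocallyLipschitzOn D Λ ∧
      (∀ ξ ∈ D, IsGloballyAsymptoticallyStable (A.hFast ξ) (Λ ξ)) ∧
      ∀ ξ' : CodeState K d, IsAsymptoticallyStable (fun ξ => A.hSlow ξ (Λ ξ)) D ξ' →
        ∀ (ℱ : Filtration ℕ ‹MeasurableSpace Ω›) (α β : ℕ → ℝ)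
          (X : ℕ → Ω → Observation m d) (ξ : ℕ → Ω → CodeState K d)
          (θ : ℕ → Ω → ParamState s d m),
          IsTwoTimescaleSteps α β → IsIdentRun A μ ℱ α β X ξ θ →
          ∀ᵐ ω ∂μ,
            (∃ C ⊆ basinOfAttraction (fun ξ => A.hSlow ξ (Λ ξ)) D ξ', IsCompact C ∧
              ∀ᶠ t in atTop, ξ t ω ∈ C) →
            Tendsto (fun t => ξ t ω) atTop (𝓝 ξ') ∧
            Tendsto (fun t => θ t ω) atTop (𝓝 (Λ ξ')) ∧
            (∀ i, Tendsto (fun t => codevector (ξ t ω) i) atTop (𝓝 (codevector ξ' i))) ∧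
            PartitionTendsto A (fun t => ξ t ω) ξ' := by
  have H := A.isAffineDissipativeOn hPE hLipFast
  obtain ⟨Λ, hΛ⟩ := H.exists_equilibrium
  refine ⟨Λ, H.locallyLipschitzOn_equilibrium hD hΛ,
    fun ξ hξ => H.isGloballyAsymptoticallyStable hΛ hξ, ?_⟩
  intro ξ' hξ' ℱ α β X ξ θ hsteps hrun
  have hθ : ∀ t ω, θ (t + 1) ω = θ t ω + α t • (A.hFast (ξ t ω) (θ t ω) +
      (A.fastUpdate (ξ t ω) (θ t ω) (X t ω) - A.hFast (ξ t ω) (θ t ω))) := fun t ω => by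
    rw [hrun.fast_step, add_sub_cancel]
  have hξ : ∀ t ω, ξ (t + 1) ω = ξ t ω + β t • (A.hSlow (ξ t ω) (θ t ω) +
      (A.slowUpdate (ξ t ω) (θ t ω) (X t ω) - A.hSlow (ξ t ω) (θ t ω))) := fun t ω => by
    rw [hrun.slow_step, add_sub_cancel]
  -- The exceptional null set is fixed before the compact set C, which may therefore depend on the
  -- realization.
  filter_upwards [H.ae_exists_tendsto_noise hD hsteps hrun.adapted_slow hrun.adapted_fast
    hrun.fast_noise hrun.slow_noise hθ] with ω hω
  rintro ⟨C, hCB, hC, hξC⟩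
  have hCD : C ⊆ D := fun u hu => by
    obtain ⟨⟨γ, hγ, rfl⟩, -⟩ := hCB hu
    exact hγ.2 0 le_rfl
  obtain ⟨hM, hN⟩ := hω C hCD hC hξC
  obtain ⟨h1, h2⟩ := H.tendsto_of_tendsto_noise hD hΛ hLipSlow
    (fun x hx θ => A.norm_hSlow_le (hpos x hx) θ) hsteps hξ' (fun t => hξ t ω)
    (fun t => hθ t ω) hM hN hC hCB hξC
  have h3 := fun i => IdentModel.tendsto_codevector h1 (hpos ξ' hξ'.mem i).ne'
  exact ⟨h1, h2, h3, A.partitionTendsto h3⟩
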